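/- **Setting.** For $m\ge 0$ let $D(m)$ be the set of pairs $(I,J)$ of non-empty disjoint subsets of $\{1,\dots,m\}$ with $|I|=|J|$ and $\min(I\cup J)\in I$. *Polytopes.* Let $P\subset\mathbb R^m$ be a polytope and $v\in\mathbb R^m$. For $z\in P$ put $\rho_zP=2z-P$. $P$ is *oriented* by $v$ if $v$ is perpendicular to no edge of $P$, and *quasi-oriented* by $v$ if $\langle -,v\rangle$ has a unique minimal element $\mathrm{bot}(P)$ and a unique maximal element $\mathrm{top}(P)$ on $P$; it is *positively* (resp. *quasi-positively*) *oriented* by $v$ if $P\cap\rho_zP$ is oriented (resp. quasi-oriented) by $v$ for every $z\in P$. Put $\pi(x,y)=\frac12(x+y)$ and $\phi(x,y)=\langle x-y,v\rangle$ on $P\times P$. The faces of $P\times P$ that are preimages under $(\pi,\phi)$ of the lower faces of the polytope $(\pi,\phi)(P\times P)\subset\mathbb R^{m+1}$ induce a coherent subdivision of $P$; it is *tight* if $\pi$ preserves the dimension of each of these faces. We say that $v$ *defines a bot-top diagonal* of $P$ if $(P,v)$ is quasi-positively oriented, this subdivision is tight, and there is a section $\triangle_{(P,v)}:P\to P\times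 P$ of $\pi$ whose value at $z$ is the unique minimizer of $\phi$ on $\pi^{-1}(z)$, with $\triangle_{(P,v)}(z)=(\mathrm{bot}(P\cap\rho_zP),\mathrm{top}(P\cap\rho_zP))$ for all $z\in P$. The vector $v$ induces on the vertices of $P$ the transitive closure of the relation "$[x,y]$ is an edge of $P$ and $\langle x,v\rangle<\langle y,v\rangle$". *Trees and nestings.* Let $t$ be a reduced planar rooted tree (every internal vertex has at least one input) with $n\ge1$ internal vertices and $n-1$ internal edges, both numbered in the order of the first visit when going clockwise around $t$ from the root; "vertex" and "edge" mean internal ones. A *nest* is a non-empty set $N$ of edges that forms a connected subgraph $t(N)$ of $t$. A *nesting* is a set of nests that contains the set $E(t)$ of all edges (if $n\ge2$), in which any two distinct nests are either comparable for inclusion or disjoint, and in the latter case have no adjacent edges. For $n=1$ the empty set is the only nesting. A nesting is *maximal* if it has maximal cardinality. The order on maximal nestings is the transitive closure of the following covering relations $\mathcal N\prec\mathcal N'$: the two nestings differ by one nest only, and for some disjoint subtrees $t_1,t_2,t_3$ the nest of $\mathcal N$ with vertices $t_1\cup t_2$ is replaced in $\mathcal N'$ either by the nest with vertices $t_2\cup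 t_3$, where $t_2$ is grafted on $t_1$ and $t_3$ on $t_2$; or by the nest with vertices $t_1\cup t_3$, where $t_2$ and $t_3$ are both grafted on $t_1$, $t_2$ to the left of $t_3$. *Loday realizations.* Let $\omega\in\mathbb Z_{>0}^n$ be a weight. For a maximal nesting $\mathcal N$ and an edge $i$, cut the subtree $t(N)$ of the smallest nest $N\in\mathcal N$ containing $i$ at the edge $i$, and let $\alpha_i$ and $\beta_i$ be the sums of the weights $\omega_j$ of the vertices $j$ of the upper and of the lower part. Put $M(t,\mathcal N,\omega)=(\alpha_1\beta_1,\dots,\alpha_{n-1}\beta_{n-1})$ and let $P_{(t,\omega)}\subset\mathbb R^{n-1}$ be the convex hull of the points $M(t,\mathcal N,\omega)$ over all maximal nestings $\mathcal N$; for $\omega=(1,\dots,1)$ it is denoted by $P_t$. **Theorem.** Let $n\ge1$ and $v=(v_1,\dots,v_{n-1})\in\mathbb R^{n-1}$. 1. If $\sum_{i\in I}v_i\ne\sum_{j\in J}v_j$ for all $(I,J)\in D(n-1)$, then for every reduced planar tree $t$ with $n$ internal vertices and every weight $\omega$ (in particular for $P_t$), $P_{(t,\omega)}$ is positively oriented by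 $v$, and $v$ defines a bot-top diagonal of $P_{(t,\omega)}$. 2. If $v_1>\dots>v_{n-1}$, then for every such $t$ and $\omega$, $v$ induces the poset of maximal nestings on the vertices of $P_{(t,\omega)}$: the map $\mathcal N\mapsto M(t,\mathcal N,\omega)$ is a bijection from the maximal nestings to the vertices of $P_{(t,\omega)}$, and $\mathcal N<\mathcal N'$ if and only if $M(t,\mathcal N,\omega)<M(t,\mathcal N',\omega)$ in the order induced by $v$. 3. If $v$ satisfies both conditions, then for every such $t$ and $\omega$, $(P_{(t,\omega)},v)$ is a well-oriented realization of the operahedron of $t$: the lattice of faces of $P_{(t,\omega)}$ (with the empty face) is isomorphic to the dual of the poset of nestings of $t$ ordered by inclusion, with a maximal element added, the maximal nesting $\mathcal N$ corresponding to the vertex $M(t,\mathcal N,\omega)$; $P_{(t,\omega)}$ is positively oriented by $v$; and $v$ induces the poset of maximal nestings on its vertices. -/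

import Mathlib

open scoped BigOperators

noncomputable section

namespace Operahedra

/-! ## Oriented polytopes and the bot-top diagonal -/

/-- The Euclidean space `ℝ^m`. -/
abbrev E (m : ℕ) : Type := EuclideanSpace ℝ (Fin m)

/-- The segment `[x, y]` is an edge (a one-dimensional face) of the polytope `P`. Faces are the
exposed faces, that is, the sets of maximisers of linear forms. -/
def IsEdge {m : ℕ} (P : Set (E m)) (x y : E m) : Prop :=
  x ≠ y ∧ IsExposed ℝ P (segment ℝ x y)

/-- `P` is oriented by `v`: no edge of `P` is perpendicular to `v`. -/
def Oriented {m : ℕ} (P : Set (E m)) (v : E m) : Prop :=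
  ∀ x y, IsEdge P x y → inner ℝ (y - x) v ≠ 0

/-- `x` is the unique minimal element `bot(P)` of `⟨-, v⟩` on `P`. -/
def IsBot {m : ℕ} (P : Set (E m)) (v x : E m) : Prop :=
  x ∈ P ∧ ∀ y ∈ P, y ≠ x → inner ℝ x v < inner ℝ y v

/-- `x` is the unique maximal element `top(P)` of `⟨-, v⟩` on `P`. -/
def IsTop {m : ℕ} (P : Set (E m)) (v x : E m) : Prop :=
  x ∈ P ∧ ∀ y ∈ P, y ≠ x → inner ℝ y v < inner ℝ x v

/-- `P` is quasi-oriented by `v`. -/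
def QuasiOriented {m : ℕ} (P : Set (E m)) (v : E m) : Prop :=
  (∃ x, IsBot P v x) ∧ ∃ x, IsTop P v x

/-- The reflection `ρ_z P = 2z - P`. -/
def reflect {m : ℕ} (z : E m) (P : Set (E m)) : Set (E m) :=
  (fun x => (2 : ℝ) • z - x) '' P

/-- `P` is positively oriented by `v`. -/
def PositivelyOriented {m : ℕ} (P : Set (E m)) (v : E m) : Prop :=
  ∀ z ∈ P, Oriented (P ∩ reflect z P) v

/-- `P` is quasi-positively oriented by `v`. -/
def QuasiPositivelyOriented {m : ℕ} (P : Set (E m)) (v : E m) : Prop :=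
  ∀ z ∈ P, QuasiOriented (P ∩ reflect z P) v

/-- The projection `π(x, y) = (x + y) / 2`. -/
def proj {m : ℕ} (q : E m × E m) : E m := (1 / 2 : ℝ) • (q.1 + q.2)

/-- The linear form `φ(x, y) = ⟨x - y, v⟩`. -/
def height {m : ℕ} (v : E m) (q : E m × E m) : ℝ := inner ℝ (q.1 - q.2) v

/-- The map `π^φ = (π, φ)`. -/
def lift {m : ℕ} (v : E m) (q : E m × E m) : E m × ℝ := (proj q, height v q)

/-- The polytope `P^φ`, the image of `P × P` under `π^φ`. -/
def lifted {m : ℕ} (P : Set (E m)) (v : E m) : Set (E m × ℝ) := lift v '' (P ×ˢ P)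

/-- `L` is a lower face of `P^φ`. -/
def IsLowerFace {m : ℕ} (P : Set (E m)) (v : E m) (L : Set (E m × ℝ)) : Prop :=
  IsExposed ℝ (lifted P v) L ∧ ∀ x ∈ L, ∀ c : ℝ, 0 < c → (x.1, x.2 - c) ∉ lifted P v

/-- The family `ℱ^φ` of faces of `P × P`: the preimages of the lower faces of `P^φ`. -/
def coherentFaces {m : ℕ} (P : Set (E m)) (v : E m) : Set (Set (E m × E m)) :=
  {S | ∃ L, IsLowerFace P v L ∧ S = (P ×ˢ P) ∩ lift v ⁻¹' L}

/-- The coherent subdivision `π(ℱ^φ)` of `P` is tight: `π` preserves the dimension of each face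
in `ℱ^φ`. -/
def InducesTightSubdivision {m : ℕ} (P : Set (E m)) (v : E m) : Prop :=
  ∀ S ∈ coherentFaces P v,
    Module.finrank ℝ (vectorSpan ℝ S) = Module.finrank ℝ (vectorSpan ℝ (proj '' S))

/-- `Δ` is the bot-top diagonal of `(P, v)`: it is the section of `π : P × P → P` whose value at
each `z` is the unique minimiser of `φ` in the fibre over `z`, and
`Δ z = (bot(P ∩ ρ_z P), top(P ∩ ρ_z P))`. -/
def IsBotTopDiagonal {m : ℕ} (P : Set (E m)) (v : E m) (Δ : P → P × P) : Prop :=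
  ∀ z : P,
    proj ((Δ z).1.1, (Δ z).2.1) = z.1 ∧
    (∀ q : P × P, proj (q.1.1, q.2.1) = z.1 → q ≠ Δ z →
      height v ((Δ z).1.1, (Δ z).2.1) < height v (q.1.1, q.2.1)) ∧
    IsBot (P ∩ reflect z.1 P) v (Δ z).1.1 ∧ IsTop (P ∩ reflect z.1 P) v (Δ z).2.1

/-- `v` defines a bot-top diagonal of `P`. -/
def DefinesBotTopDiagonal {m : ℕ} (P : Set (E m)) (v : E m) : Prop :=
  QuasiPositivelyOriented P v ∧ InducesTightSubdivision P v ∧ ∃ Δ, IsBotTopDiagonal P v Δ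

/-- The strict order that `v` induces on the vertices of `P`: the transitive closure of the
1-skeleton of `P`, each edge being oriented in the direction of increasing `⟨-, v⟩`. -/
def VertexLT {m : ℕ} (P : Set (E m)) (v : E m) : E m → E m → Prop :=
  Relation.TransGen fun x y => IsEdge P x y ∧ inner ℝ x v < inner ℝ y v

/-- The index set `D(m)`: pairs of disjoint subsets `I`, `J` of the same cardinality such that
`I ∪ J` has a minimum and this minimum lies in `I` (so `I` and `J` are not empty). -/
def D (m : ℕ) : Set (Finset (Fin m) × Finset (Fin m)) :=
  {p | p.1.card = p.2.card ∧ Disjoint p.1 p.2 ∧ ∃ i ∈ p.1, ∀ k ∈ p.1 ∪ p.2, i ≤ k}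

/-! ## Planar trees -/

/-- Reduced planar rooted trees. A tree is a single leaf, or a root vertex with a non-empty
list of inputs `first :: rest` from left to right. The nodes are the internal vertices. -/
inductive PlanarTree : Type
  | leaf : PlanarTree
  | node (first : PlanarTree) (rest : List PlanarTree) : PlanarTree

mutual
/-- The number of internal vertices. -/
def PlanarTree.numVertices : PlanarTree → ℕ
  | .leaf => 0
  | .node c cs => 1 + (c.numVertices + PlanarTree.numVerticesList cs)
/-- The number of internal vertices of a forest. -/
def PlanarTree.numVerticesList : List PlanarTree → ℕ
  | [] => 0
  | c :: cs => c.numVertices + PlanarTree.numVerticesList cs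
end

mutual
/-- Traverse the tree clockwise from the root (each vertex before its inputs, the inputs from left
to right) and number the internal vertices `k, k + 1, …` in the order of their first visit. The
result is the list of the numbers of the parents of these vertices, in this order; `p` is the number
of the vertex below the tree. -/
def PlanarTree.parentsFrom (p k : ℕ) : PlanarTree → List ℕ
  | .leaf => []
  | .node c cs => p :: (PlanarTree.parentsFrom k (k + 1) c ++
      PlanarTree.parentsFromList k (k + 1 + c.numVertices) cs)
/-- The same for a forest whose trees are all attached to the vertex `p`. -/
def PlanarTree.parentsFromList (p k : ℕ) : List PlanarTree → List ℕ
  | [] => []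
  | c :: cs => PlanarTree.parentsFrom p k c ++
      PlanarTree.parentsFromList p (k + c.numVertices) cs
end

mutual
theorem PlanarTree.length_parentsFrom (p k : ℕ) :
    ∀ t : PlanarTree, (t.parentsFrom p k).length = t.numVertices
  | .leaf => by simp [PlanarTree.parentsFrom, PlanarTree.numVertices]
  | .node c cs => by
      simp [PlanarTree.parentsFrom, PlanarTree.numVertices,
        PlanarTree.length_parentsFrom k (k + 1) c,
        PlanarTree.length_parentsFromList k (k + 1 + c.numVertices) cs]
      omega
theorem PlanarTree.length_parentsFromList (p k : ℕ) :
    ∀ l : List PlanarTree,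
      (PlanarTree.parentsFromList p k l).length = PlanarTree.numVerticesList l
  | [] => by simp [PlanarTree.parentsFromList, PlanarTree.numVerticesList]
  | c :: cs => by
      simp [PlanarTree.parentsFromList, PlanarTree.numVerticesList,
        PlanarTree.length_parentsFrom p k c,
        PlanarTree.length_parentsFromList p (k + c.numVertices) cs]
end

mutual
theorem PlanarTree.parentsFrom_lt (p k : ℕ) (hp : p < k) :
    ∀ (t : PlanarTree) (i : ℕ) (hi : i < (t.parentsFrom p k).length),
      (t.parentsFrom p k)[i] < k + i
  | .leaf, i, hi => by simp [PlanarTree.parentsFrom] at hi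
  | .node c cs, i, hi => by
      have h1 := PlanarTree.parentsFrom_lt k (k + 1) (by omega) c
      have h2 := PlanarTree.parentsFromList_lt k (k + 1 + c.numVertices) (by omega) cs
      have h3 := PlanarTree.length_parentsFrom k (k + 1) c
      simp only [PlanarTree.parentsFrom] at hi ⊢
      cases i with
      | zero => simpa using hp
      | succ i =>
        rw [List.getElem_cons_succ, List.getElem_append]
        split
        · rename_i h
          have := h1 i h
          omega
        · rename_i h
          simp only [List.length_cons, List.length_append] at hi
          have := h2 (i - (c.parentsFrom k (k + 1)).length) (by omega)
          omega
theorem PlanarTree.parentsFromList_lt (p k : ℕ) (hp : p < k) :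
    ∀ (l : List PlanarTree) (i : ℕ) (hi : i < (PlanarTree.parentsFromList p k l).length),
      (PlanarTree.parentsFromList p k l)[i] < k + i
  | [], i, hi => by simp [PlanarTree.parentsFromList] at hi
  | c :: cs, i, hi => by
      have h1 := PlanarTree.parentsFrom_lt p k hp c
      have h2 := PlanarTree.parentsFromList_lt p (k + c.numVertices) (by omega) cs
      have h3 := PlanarTree.length_parentsFrom p k c
      simp only [PlanarTree.parentsFromList] at hi ⊢
      rw [List.getElem_append]
      split
      · rename_i h
        exact h1 i h
      · rename_i h
        simp only [List.length_append] at hi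
        have := h2 (i - (c.parentsFrom p k).length) (by omega)
        omega
end

/-- For each internal vertex other than the root vertex, in the clockwise order, the number of its
parent. The root vertex has the number `0`. -/
def PlanarTree.parents (t : PlanarTree) : List ℕ := (t.parentsFrom 0 0).tail

theorem PlanarTree.length_parents (t : PlanarTree) : t.parents.length = t.numVertices - 1 := by
  simp [PlanarTree.parents, PlanarTree.length_parentsFrom]

theorem PlanarTree.parents_lt (t : PlanarTree) (i : ℕ) (hi : i < t.parents.length) :
    t.parents[i] < i + 1 := by
  cases t with
  | leaf => simp [PlanarTree.parents, PlanarTree.parentsFrom] at hi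
  | node c cs =>
    have h : (PlanarTree.node c cs).parents = PlanarTree.parentsFromList 0 1 (c :: cs) := by
      simp [PlanarTree.parents, PlanarTree.parentsFrom, PlanarTree.parentsFromList]
    simp only [h] at hi ⊢
    have := PlanarTree.parentsFromList_lt 0 1 (by omega) (c :: cs) i hi
    omega

/-- The set `PT_n` of reduced planar rooted trees with `n` internal vertices. -/
structure PT (n : ℕ) where
  tree : PlanarTree
  card : tree.numVertices = n

/-! A tree in `PT (m + 1)` has the vertices `V(t) = Fin (m + 1)` and the edges `E(t) = Fin m`, both
numbered in the clockwise order (from `0`): the edge `e` joins the vertex `e + 1` to its parent. -/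

namespace PT

variable {m : ℕ}

/-- The lower end of an edge. -/
def src (t : PT (m + 1)) (e : Fin m) : Fin (m + 1) :=
  ⟨t.tree.parents[e.1]'(by rw [PlanarTree.length_parents, t.card]; exact e.2),
    lt_of_lt_of_le (PlanarTree.parents_lt _ _ _) (by have := e.2; omega)⟩

/-- The upper end of an edge. -/
def tgt (_t : PT (m + 1)) (e : Fin m) : Fin (m + 1) := e.succ

theorem src_lt_tgt (t : PT (m + 1)) (e : Fin m) : t.src e < t.tgt e := by
  rw [Fin.lt_def]
  exact PlanarTree.parents_lt t.tree e.1 _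

/-- The vertex `x` is an end of the edge `e`. -/
def Incident (t : PT (m + 1)) (e : Fin m) (x : Fin (m + 1)) : Prop := x = t.src e ∨ x = t.tgt e

/-- The vertices adjacent to an edge in `N`. -/
def verts (t : PT (m + 1)) (N : Finset (Fin m)) : Set (Fin (m + 1)) :=
  {x | ∃ e ∈ N, t.Incident e x}

/-- The graph on `V(t)` whose edges are those in `N`. -/
def edgeGraph (t : PT (m + 1)) (N : Finset (Fin m)) : SimpleGraph (Fin (m + 1)) where
  Adj x y := ∃ e ∈ N, (x = t.src e ∧ y = t.tgt e) ∨ (x = t.tgt e ∧ y = t.src e)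
  symm := ⟨by
    rintro x y ⟨e, he, h | h⟩
    · exact ⟨e, he, Or.inr ⟨h.2, h.1⟩⟩
    · exact ⟨e, he, Or.inl ⟨h.2, h.1⟩⟩⟩
  loopless := ⟨by
    rintro x ⟨e, _, h | h⟩
    · exact absurd (h.1.symm.trans h.2) (t.src_lt_tgt e).ne
    · exact absurd (h.2.symm.trans h.1) (t.src_lt_tgt e).ne⟩

/-- The closure of `N`: the subgraph with the edges in `N` and the vertices adjacent to them. -/
def closure (t : PT (m + 1)) (N : Finset (Fin m)) : SimpleGraph (t.verts N) :=
  (t.edgeGraph N).induce (t.verts N)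

/-- Nests. -/
def IsNest (t : PT (m + 1)) (N : Finset (Fin m)) : Prop := N.Nonempty ∧ (t.closure N).Connected

/-- Two edges with a common end. -/
def EdgeAdj (t : PT (m + 1)) (e f : Fin m) : Prop := ∃ x, t.Incident e x ∧ t.Incident f x

/-- Nestings. A corolla (`m = 0`) has no nest; the empty set of nests counts as its only nesting. -/
structure IsNesting (t : PT (m + 1)) (𝒩 : Finset (Finset (Fin m))) : Prop where
  nest : ∀ N ∈ 𝒩, t.IsNest N
  trivial_mem : 0 < m → Finset.univ ∈ 𝒩
  laminar : ∀ N ∈ 𝒩, ∀ N' ∈ 𝒩, N ≠ N' → N ⊂ N' ∨ N' ⊂ N ∨ Disjoint N N'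
  nonadjacent : ∀ N ∈ 𝒩, ∀ N' ∈ 𝒩, Disjoint N N' → ∀ e ∈ N, ∀ f ∈ N', ¬ t.EdgeAdj e f

/-- The poset of nestings of `t`, ordered by inclusion. -/
abbrev Nesting (t : PT (m + 1)) : Type := {𝒩 : Finset (Finset (Fin m)) // t.IsNesting 𝒩}

/-- The set of maximal nestings: those of maximal cardinality. -/
def maximalNestings (t : PT (m + 1)) : Set (Finset (Finset (Fin m))) :=
  {𝒩 | t.IsNesting 𝒩 ∧ ∀ 𝒩', t.IsNesting 𝒩' → 𝒩'.card ≤ 𝒩.card}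

/-- The edges of `t` with both ends in the set of vertices `T`. -/
def inside (t : PT (m + 1)) (T : Finset (Fin (m + 1))) : Finset (Fin m) :=
  Finset.univ.filter fun e => t.src e ∈ T ∧ t.tgt e ∈ T

/-- `T` is the vertex set of a subtree of `t`. -/
def IsSubtree (t : PT (m + 1)) (T : Finset (Fin (m + 1))) : Prop :=
  ((t.edgeGraph Finset.univ).induce (T : Set (Fin (m + 1)))).Connected

/-- The covering relations between maximal nestings: `𝒩` and `𝒩'` differ by one nest only, and
there are disjoint subtrees `T₁`, `T₂`, `T₃` of `t` and two edges `e`, `f` such that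
* either `e` is an input of `T₁` and the root of `T₂`, and `f` is an input of `T₂` and the root of
  `T₃`; the nest `T₁ ∪ T₂` of `𝒩` is replaced by the nest `T₂ ∪ T₃` of `𝒩'`;
* or `e` and `f` are inputs of `T₁`, with `e` on the left of `f` (that is, `e < f`), `e` is the root
  of `T₂` and `f` is the root of `T₃`; the nest `T₁ ∪ T₂` of `𝒩` is replaced by the nest
  `T₁ ∪ T₃` of `𝒩'`. -/
def Covers (t : PT (m + 1)) (𝒩 𝒩' : Finset (Finset (Fin m))) : Prop :=
  𝒩 ∈ t.maximalNestings ∧ 𝒩' ∈ t.maximalNestings ∧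
  ∃ (N N' : Finset (Fin m)) (T₁ T₂ T₃ : Finset (Fin (m + 1))) (e f : Fin m),
    N ∈ 𝒩 ∧ N' ∈ 𝒩' ∧ 𝒩.erase N = 𝒩'.erase N' ∧
    t.IsSubtree T₁ ∧ t.IsSubtree T₂ ∧ t.IsSubtree T₃ ∧
    Disjoint T₁ T₂ ∧ Disjoint T₁ T₃ ∧ Disjoint T₂ T₃ ∧
    t.src e ∈ T₁ ∧ t.tgt e ∈ T₂ ∧ t.tgt f ∈ T₃ ∧ N = t.inside (T₁ ∪ T₂) ∧
    ((t.src f ∈ T₂ ∧ N' = t.inside (T₂ ∪ T₃)) ∨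
      (t.src f ∈ T₁ ∧ e < f ∧ N' = t.inside (T₁ ∪ T₃)))

/-- The strict order of the poset of maximal nestings. -/
def NestingLT (t : PT (m + 1)) : Finset (Finset (Fin m)) → Finset (Finset (Fin m)) → Prop :=
  Relation.TransGen t.Covers

/-! ## Loday realizations -/

/-- `min 𝒩(e)`: the nests of the nesting `𝒩` containing `e` form a finite chain, so their
intersection is their minimum. -/
def minNest (𝒩 : Finset (Finset (Fin m))) (e : Fin m) : Finset (Fin m) :=
  (𝒩.filter fun N => e ∈ N).inf id

/-- The tree `t(min 𝒩(i))` cut at the edge `i`. -/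
def cutGraph (t : PT (m + 1)) (𝒩 : Finset (Finset (Fin m))) (i : Fin m) :
    SimpleGraph (Fin (m + 1)) :=
  t.edgeGraph ((minNest 𝒩 i).erase i)

open Classical in
/-- `α_i`: the total weight of the part of `t(min 𝒩(i))` above the edge `i`. -/
def alpha (t : PT (m + 1)) (ω : Fin (m + 1) → ℕ+) (𝒩 : Finset (Finset (Fin m))) (i : Fin m) : ℝ :=
  ∑ j ∈ Finset.univ.filter fun j => (t.cutGraph 𝒩 i).Reachable (t.tgt i) j, ((ω j : ℕ) : ℝ)

open Classical in
/-- `β_i`: the total weight of the part of `t(min 𝒩(i))` below the edge `i`. -/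
def beta (t : PT (m + 1)) (ω : Fin (m + 1) → ℕ+) (𝒩 : Finset (Finset (Fin m))) (i : Fin m) : ℝ :=
  ∑ j ∈ Finset.univ.filter fun j => (t.cutGraph 𝒩 i).Reachable (t.src i) j, ((ω j : ℕ) : ℝ)

/-- The point `M(t, 𝒩, ω) = (α_1 β_1, …, α_m β_m)`. -/
def lodayPoint (t : PT (m + 1)) (ω : Fin (m + 1) → ℕ+) (𝒩 : Finset (Finset (Fin m))) : E m :=
  WithLp.toLp 2 fun i => t.alpha ω 𝒩 i * t.beta ω 𝒩 i

/-- The Loday realization `P_{(t, ω)}` of weight `ω` of the operahedron. -/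
def lodayPolytope (t : PT (m + 1)) (ω : Fin (m + 1) → ℕ+) : Set (E m) :=
  convexHull ℝ (t.lodayPoint ω '' t.maximalNestings)

/-- `P` is a realization of the operahedron of `t`, with `p 𝒩` the vertex for the maximal
nesting `𝒩`: the lattice of faces of `P` (the empty face included) is isomorphic to the dual of the
lattice of nestings of `t` (with a maximal element added), and the isomorphism sends the face
`{p 𝒩}` to `𝒩`. -/
def IsRealization (t : PT (m + 1)) (P : Set (E m)) (p : Finset (Finset (Fin m)) → E m) : Prop :=
  ∃ Φ : (WithTop t.Nesting)ᵒᵈ ≃o {F : Set (E m) // IsExposed ℝ P F},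
    ∀ 𝒩 : t.Nesting, 𝒩.1 ∈ t.maximalNestings →
      (Φ (OrderDual.toDual (𝒩 : WithTop t.Nesting))).1 = {p 𝒩.1}

/-- `v` induces the poset of maximal nestings of `t` on the vertices of `P`, where `p 𝒩` is the
vertex for `𝒩`. -/
def InducesNestingPoset (t : PT (m + 1)) (P : Set (E m)) (v : E m)
    (p : Finset (Finset (Fin m)) → E m) : Prop :=
  Set.BijOn p t.maximalNestings (P.extremePoints ℝ) ∧
  ∀ 𝒩 ∈ t.maximalNestings, ∀ 𝒩' ∈ t.maximalNestings,
    t.NestingLT 𝒩 𝒩' ↔ VertexLT P v (p 𝒩) (p 𝒩')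

/-- `(P, v)` is a well-oriented realization of the operahedron of `t`. -/
def IsWellOriented (t : PT (m + 1)) (P : Set (E m)) (v : E m)
    (p : Finset (Finset (Fin m)) → E m) : Prop :=
  t.IsRealization P p ∧ PositivelyOriented P v ∧ t.InducesNestingPoset P v p

end PT

end Operahedra

end

open Operahedra

-- Inequalities. For a set $N$ of edges, `bound` sums $\omega_x\omega_y$ over the pairs of distinct
-- vertices connected by $N$. The coordinate $\alpha_i\beta_i$ of a Loday point is the same sum over
-- the pairs separated when the smallest nest containing $i$ is cut at $i$. In a maximal nesting
-- $\mathcal N$ each pair is separated at exactly one edge, and this edge lies on the path between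
-- the two vertices. Hence the coordinates with index in $N$ sum to at least `bound`, and for a nest
-- $N$ equality holds iff $N\in\mathcal N$ (`bound_le_sum`, `sum_eq_bound_iff`).
--
-- Faces. The components of the superlevel sets of the coefficients of a linear form are a nesting,
-- and the form is a combination of the sums over its nests, with positive coefficients except
-- perhaps at $E(t)$, where the sum is constant on the polytope (`exists_nesting_linear_eq`). So
-- each linear form is least exactly on the face cut out by a nesting. This gives the description by
-- inequalities (`mem_lodayPolytope`) and the face lattice (`exists_face_eq`, `face_subset_face`).
--
-- Diagonal. Let $x\ne y$ in $P\cap\rho_zP$. The constraints tight at the midpoint, and those tight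
-- at its reflection, form two nestings. Each partitions the edges by smallest nest, and $y-x$ sums
-- to zero over every block of both partitions. Alternating between positive and negative entries
-- yields disjoint $I,J$ with equally many elements in each block (`exists_alternating`). Then one
-- can move from the midpoint along $\pm(1_I-1_J)$ inside $P\cap\rho_zP$, and by hypothesis this
-- direction is not perpendicular to $v$ (`exists_direction`). So no edge is perpendicular to $v$
-- and minima are unique, which gives the diagonal and tightness.
--
-- Order. Edges of the polytope join maximal nestings that differ in one nest: some $K$ is cut first
-- at $f$ and then at $e$, or the other way round. The two points differ by a positive multiple of
-- $e_e-e_f$, so for decreasing $v$ the edge ascends iff $e<f$, and by the clockwise numbering this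
-- is the covering relation (`covers_iff`).

namespace Operahedra.PT

variable {m : ℕ}

/-! ## Connectivity in trees -/

/-- The vertices `x` and `y` are joined by a path all of whose edges are in `S`. -/
def Reach (t : PT (m + 1)) (S : Finset (Fin m)) (x y : Fin (m + 1)) : Prop :=
  (t.edgeGraph S).Reachable x y

namespace Reach

variable {t : PT (m + 1)} {S S' : Finset (Fin m)} {x y z : Fin (m + 1)} {e : Fin m}

theorem refl (t : PT (m + 1)) (S : Finset (Fin m)) (x : Fin (m + 1)) : t.Reach S x x :=
  SimpleGraph.Reachable.refl x

theorem symm (h : t.Reach S x y) : t.Reach S y x := SimpleGraph.Reachable.symm h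

theorem trans (h : t.Reach S x y) (h' : t.Reach S y z) : t.Reach S x z :=
  SimpleGraph.Reachable.trans h h'

theorem edge (he : e ∈ S) : t.Reach S (t.src e) (t.tgt e) :=
  SimpleGraph.Adj.reachable (show (t.edgeGraph S).Adj _ _ from ⟨e, he, Or.inl ⟨rfl, rfl⟩⟩)

theorem of_incident (he : e ∈ S) (hx : t.Incident e x) (hy : t.Incident e y) :
    t.Reach S x y := by
  rcases hx with rfl | rfl <;> rcases hy with rfl | rfl
  · exact refl ..
  · exact edge he
  · exact (edge he).symm
  · exact refl ..

/-- A property of vertices that is preserved along the edges in `S` is preserved by paths. -/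
theorem induct {p : Fin (m + 1) → Prop} (h : t.Reach S x y) (hx : p x)
    (step : ∀ e ∈ S, ∀ a b, t.Incident e a → t.Incident e b → t.Reach S x a → p a → p b) :
    p y := by
  obtain ⟨w⟩ := h
  suffices ∀ (a b : Fin (m + 1)) (_ : (t.edgeGraph S).Walk a b), t.Reach S x a → p a → p b from
    this x y w (refl ..) hx
  intro a b w
  induction w with
  | nil => exact fun _ h => h
  | cons hadj w ih =>
    intro hxa ha
    obtain ⟨e, he, h | h⟩ := hadj
    · exact ih (hxa.trans (of_incident he (Or.inl h.1) (Or.inr h.2)))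
        (step e he _ _ (Or.inl h.1) (Or.inr h.2) hxa ha)
    · exact ih (hxa.trans (of_incident he (Or.inr h.1) (Or.inl h.2)))
        (step e he _ _ (Or.inr h.1) (Or.inl h.2) hxa ha)

theorem mono (h : t.Reach S x y) (hS : S ⊆ S') : t.Reach S' x y :=
  h.induct (p := fun y => t.Reach S' x y) (refl ..)
    fun _ he _ _ ha hb _ hxa => hxa.trans (of_incident (hS he) ha hb)

/-- A nontrivial path starts with an edge. -/
theorem exists_first_edge (h : t.Reach S x y) (hxy : x ≠ y) : ∃ e ∈ S, t.Incident e x := by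
  by_contra! hcon
  refine hxy (h.induct (p := fun y => x = y) rfl fun e he a b ha _ _ hxa => ?_)
  subst hxa
  exact absurd ha (hcon e he)

end Reach

/-- `x` is above the edge `e`. -/
def Above (t : PT (m + 1)) (e : Fin m) (x : Fin (m + 1)) : Prop :=
  Relation.ReflTransGen (fun a b => ∃ g, a = t.src g ∧ b = t.tgt g) (t.tgt e) x

section Above

variable {t : PT (m + 1)} {S : Finset (Fin m)} {x y : Fin (m + 1)} {e f : Fin m}

theorem Above.le (h : t.Above e x) : t.tgt e ≤ x := by
  induction h with
  | refl => exact le_rfl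
  | tail _ h ih =>
    obtain ⟨g, rfl, rfl⟩ := h
    exact ih.trans (t.src_lt_tgt g).le

theorem tgt_injective (t : PT (m + 1)) : Function.Injective t.tgt := Fin.succ_injective m

/-- An edge is determined by its upper end, so parents are unique and only `e` itself leads from
below `e` to above it. -/
theorem above_src_iff_tgt (h : f ≠ e) : t.Above e (t.src f) ↔ t.Above e (t.tgt f) := by
  refine ⟨fun hs => hs.tail ⟨f, rfl, rfl⟩, fun ht => ?_⟩
  rcases Relation.ReflTransGen.cases_tail ht with h' | ⟨c, hc, g, rfl, hg⟩
  · exact absurd (t.tgt_injective h') h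
  · rw [t.tgt_injective hg]
    exact hc

theorem not_above_src (t : PT (m + 1)) (e : Fin m) : ¬ t.Above e (t.src e) :=
  fun h => absurd h.le (not_le.2 (t.src_lt_tgt e))

theorem above_tgt (t : PT (m + 1)) (e : Fin m) : t.Above e (t.tgt e) := Relation.ReflTransGen.refl

theorem Above.of_reach (h : t.Reach S x y) (he : e ∉ S) (hx : t.Above e x) : t.Above e y := by
  refine h.induct hx fun f hf a b ha hb _ h => ?_
  have hfe : f ≠ e := fun h => he (h ▸ hf)
  rcases ha with rfl | rfl <;> rcases hb with rfl | rfl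
  · exact h
  · exact (above_src_iff_tgt hfe).1 h
  · exact (above_src_iff_tgt hfe).2 h
  · exact h

/-- Trees have no cycles. -/
theorem not_reach_of_notMem (he : e ∉ S) : ¬ t.Reach S (t.src e) (t.tgt e) :=
  fun h => t.not_above_src e (Above.of_reach h.symm he (t.above_tgt e))

theorem reach_src_iff (he : e ∈ S) : t.Reach S (t.src e) x ↔
    t.Reach (S.erase e) (t.src e) x ∨ t.Reach (S.erase e) (t.tgt e) x := by
  constructor
  · intro h
    refine h.induct (p := fun x => t.Reach (S.erase e) (t.src e) x ∨
      t.Reach (S.erase e) (t.tgt e) x) (Or.inl (Reach.refl ..)) fun f hf a b ha hb _ h => ?_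
    by_cases hfe : f = e
    · subst hfe
      rcases hb with rfl | rfl
      · exact Or.inl (Reach.refl ..)
      · exact Or.inr (Reach.refl ..)
    · have := Reach.of_incident (Finset.mem_erase.2 ⟨hfe, hf⟩) ha hb
      exact h.imp (fun h => h.trans this) (fun h => h.trans this)
  · rintro (h | h)
    · exact h.mono (Finset.erase_subset _ _)
    · exact (Reach.edge he).trans (h.mono (Finset.erase_subset _ _))

/-- The pairs of vertices that are separated when `S` is cut at the edge `e`. -/
theorem separated_iff (he : e ∈ S) : (t.Reach S x y ∧ ¬ t.Reach (S.erase e) x y) ↔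
    (t.Reach (S.erase e) (t.tgt e) x ∧ t.Reach (S.erase e) (t.src e) y) ∨
    (t.Reach (S.erase e) (t.src e) x ∧ t.Reach (S.erase e) (t.tgt e) y) := by
  have hn : ¬ t.Reach (S.erase e) (t.src e) (t.tgt e) :=
    not_reach_of_notMem (Finset.notMem_erase e S)
  constructor
  · rintro ⟨h, h'⟩
    by_cases hx : t.Reach S (t.src e) x
    · have hy := hx.trans h
      rcases (reach_src_iff he).1 hx with h1 | h1 <;> rcases (reach_src_iff he).1 hy with h2 | h2
      · exact absurd (h1.symm.trans h2) h'
      · exact Or.inr ⟨h1, h2⟩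
      · exact Or.inl ⟨h1, h2⟩
      · exact absurd (h1.symm.trans h2) h'
    · refine absurd (h.induct (p := fun y => t.Reach (S.erase e) x y) (Reach.refl ..)
        fun f hf a b ha hb hxa h => h.trans ?_) h'
      refine Reach.of_incident (Finset.mem_erase.2 ⟨?_, hf⟩) ha hb
      rintro rfl
      exact hx ((Reach.of_incident hf (Or.inl rfl) ha).trans hxa.symm)
  · rintro (⟨h1, h2⟩ | ⟨h1, h2⟩)
    · refine ⟨((h1.mono (Finset.erase_subset _ _)).symm.trans (Reach.edge he).symm).trans
        (h2.mono (Finset.erase_subset _ _)), fun h => hn ?_⟩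
      exact (h2.trans h.symm).trans h1.symm
    · refine ⟨((h1.mono (Finset.erase_subset _ _)).symm.trans (Reach.edge he)).trans
        (h2.mono (Finset.erase_subset _ _)), fun h => hn ?_⟩
      exact (h1.trans h).trans h2.symm

end Above

/-! ## Nests -/

section Nest

variable {t : PT (m + 1)} {S N A : Finset (Fin m)} {x y : Fin (m + 1)} {e f : Fin m}

theorem incident_src (t : PT (m + 1)) (e : Fin m) : t.Incident e (t.src e) := Or.inl rfl

theorem incident_tgt (t : PT (m + 1)) (e : Fin m) : t.Incident e (t.tgt e) := Or.inr rfl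

theorem EdgeAdj.symm (h : t.EdgeAdj e f) : t.EdgeAdj f e := h.imp fun _ h => ⟨h.2, h.1⟩

theorem EdgeAdj.refl (t : PT (m + 1)) (e : Fin m) : t.EdgeAdj e e :=
  ⟨t.src e, t.incident_src e, t.incident_src e⟩

theorem Reach.reachable_closure (h : t.Reach N x y) (hx : x ∈ t.verts N) :
    ∃ hy : y ∈ t.verts N, (t.closure N).Reachable ⟨x, hx⟩ ⟨y, hy⟩ := by
  refine h.induct (p := fun y => ∃ hy : y ∈ t.verts N,
    (t.closure N).Reachable ⟨x, hx⟩ ⟨y, hy⟩) ⟨hx, SimpleGraph.Reachable.refl _⟩ ?_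
  rintro e he a b ha hb _ ⟨ha', h⟩
  refine ⟨⟨e, he, hb⟩, ?_⟩
  by_cases hab : a = b
  · subst hab; exact h
  refine h.trans (SimpleGraph.Adj.reachable ?_)
  show (t.edgeGraph N).Adj a b
  rcases ha with rfl | rfl <;> rcases hb with rfl | rfl
  · exact absurd rfl hab
  · exact ⟨e, he, Or.inl ⟨rfl, rfl⟩⟩
  · exact ⟨e, he, Or.inr ⟨rfl, rfl⟩⟩
  · exact absurd rfl hab

/-- Replaces the induced subgraph on a subtype by paths on all of `V(t)`: a path in `N` that starts
in `verts` never leaves it. -/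
theorem isNest_iff_reach : t.IsNest N ↔
    N.Nonempty ∧ ∀ x ∈ t.verts N, ∀ y ∈ t.verts N, t.Reach N x y := by
  constructor
  · rintro ⟨hne, hc⟩
    refine ⟨hne, fun x hx y hy => ?_⟩
    exact (hc.preconnected ⟨x, hx⟩ ⟨y, hy⟩).map (SimpleGraph.Embedding.induce _).toHom
  · rintro ⟨⟨e, he⟩, h⟩
    refine ⟨⟨e, he⟩, ?_⟩
    have : Nonempty (t.verts N) := ⟨⟨t.src e, e, he, t.incident_src e⟩⟩
    refine ⟨fun x y => ?_⟩
    exact ((h x x.2 y y.2).reachable_closure x.2).2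

theorem IsNest.reach (h : t.IsNest N) (he : e ∈ N) (hf : f ∈ N) (hx : t.Incident e x)
    (hy : t.Incident f y) : t.Reach N x y :=
  (isNest_iff_reach.1 h).2 x ⟨e, he, hx⟩ y ⟨f, hf, hy⟩

/-- A subset `A` of a set of edges `S` that contains with `e` also all edges of `S` adjacent to `e`
contains the edges at all vertices that can be reached from it. -/
theorem Reach.mem_of_closed (h : t.Reach S x y) (he : e ∈ A) (hx : t.Incident e x)
    (hA : ∀ a ∈ A, ∀ b ∈ S, t.EdgeAdj a b → b ∈ A) :
    t.Reach A x y ∧ ∃ a ∈ A, t.Incident a y := by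
  refine h.induct (p := fun y => t.Reach A x y ∧ ∃ a ∈ A, t.Incident a y)
    ⟨Reach.refl .., e, he, hx⟩ ?_
  rintro g hg a b ha hb _ ⟨h, a', ha', ha''⟩
  have hgA := hA a' ha' g hg ⟨a, ha'', ha⟩
  exact ⟨h.trans (Reach.of_incident hgA ha hb), g, hgA, hb⟩

/-- A nest is not the union of two non-adjacent parts. -/
theorem IsNest.subset_of_closed (h : t.IsNest N) (he : e ∈ N) (heA : e ∈ A)
    (hA : ∀ a ∈ A, ∀ b ∈ N, t.EdgeAdj a b → b ∈ A) : N ⊆ A := by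
  intro f hf
  obtain ⟨-, a, ha, ha'⟩ := (h.reach he hf (t.incident_src e) (t.incident_src f)).mem_of_closed
    heA (t.incident_src e) hA
  exact hA a ha f hf ⟨_, ha', t.incident_src f⟩

/-- A nest that meets `A` without being contained in it has an edge outside `A` that is adjacent
to an edge in `A`. -/
theorem IsNest.exists_adj (h : t.IsNest N) (he : e ∈ N) (heA : e ∈ A) (hN : ¬ N ⊆ A) :
    ∃ a ∈ A, ∃ b ∈ N, b ∉ A ∧ t.EdgeAdj a b := by
  by_contra! hcon
  exact hN (h.subset_of_closed he heA fun a ha b hb hab => by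
    by_contra hbA
    exact hcon a ha b hb hbA hab)

open Classical in
/-- The connected component of the edge `e` in the set of edges `S`. -/
noncomputable def component (t : PT (m + 1)) (S : Finset (Fin m)) (e : Fin m) : Finset (Fin m) :=
  S.filter fun f => t.Reach S (t.src e) (t.src f)

theorem mem_component : f ∈ t.component S e ↔ f ∈ S ∧ t.Reach S (t.src e) (t.src f) := by
  classical
  simp [component]

theorem component_closed (hf : f ∈ t.component S e) {g : Fin m} (hg : g ∈ S)
    (h : t.EdgeAdj f g) : g ∈ t.component S e := by
  obtain ⟨hfS, hf⟩ := mem_component.1 hf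
  obtain ⟨x, hx, hx'⟩ := h
  exact mem_component.2 ⟨hg, (hf.trans (Reach.of_incident hfS (t.incident_src f) hx)).trans
    (Reach.of_incident hg hx' (t.incident_src g))⟩

theorem self_mem_component (he : e ∈ S) : e ∈ t.component S e :=
  mem_component.2 ⟨he, Reach.refl ..⟩

theorem isNest_component (he : e ∈ S) : t.IsNest (t.component S e) := by
  refine isNest_iff_reach.2 ⟨⟨e, self_mem_component he⟩, ?_⟩
  have key : ∀ x ∈ t.verts (t.component S e), t.Reach (t.component S e) (t.src e) x := by
    rintro x ⟨f, hf, hx⟩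
    obtain ⟨hfS, h⟩ := mem_component.1 hf
    exact (h.mem_of_closed (self_mem_component he) (t.incident_src e)
      fun a ha b hb hab => component_closed ha hb hab).1.trans
      (Reach.of_incident hf (t.incident_src f) hx)
  exact fun x hx y hy => (key x hx).symm.trans (key y hy)

theorem IsNest.subset_component (h : t.IsNest N) (he : e ∈ N) (hN : N ⊆ S) :
    N ⊆ t.component S e := fun _ hf =>
  mem_component.2 ⟨hN hf, (h.reach he hf (t.incident_src e) (t.incident_src _)).mono hN⟩

/-- A parent has a smaller number than its child, so descending along parents ends at the root `0`.
-/
theorem reach_univ (t : PT (m + 1)) (x y : Fin (m + 1)) : t.Reach Finset.univ x y := by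
  suffices ∀ x, t.Reach Finset.univ 0 x from (this x).symm.trans (this y)
  intro x
  induction x using WellFoundedLT.induction with
  | ind x ih =>
    cases x using Fin.cases with
    | zero => exact Reach.refl ..
    | succ i => exact (ih _ (t.src_lt_tgt i)).trans (Reach.edge (Finset.mem_univ i))

theorem isNest_univ (t : PT (m + 1)) (hm : 0 < m) : t.IsNest Finset.univ :=
  isNest_iff_reach.2 ⟨⟨⟨0, hm⟩, Finset.mem_univ _⟩, fun x _ y _ => t.reach_univ x y⟩

end Nest

end Operahedra.PT

namespace Operahedra.PT

variable {m : ℕ} {t : PT (m + 1)}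

/-! ## Nestings -/

section Nesting

variable {𝒩 𝒩' ℳ : Finset (Finset (Fin m))} {N N' K : Finset (Fin m)} {e f : Fin m}

theorem IsNesting.univ_mem (h : t.IsNesting 𝒩) (e : Fin m) : Finset.univ ∈ 𝒩 :=
  h.trivial_mem (Nat.zero_lt_of_lt e.2)

theorem IsNesting.of_subset (h : t.IsNesting 𝒩) (hs : ℳ ⊆ 𝒩) (hu : 0 < m → Finset.univ ∈ ℳ) :
    t.IsNesting ℳ where
  nest N hN := h.nest N (hs hN)
  trivial_mem := hu
  laminar N hN N' hN' := h.laminar N (hs hN) N' (hs hN')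
  nonadjacent N hN N' hN' := h.nonadjacent N (hs hN) N' (hs hN')

/-- Two nests of a nesting that contain equal or adjacent edges are comparable. -/
theorem IsNesting.comparable (h : t.IsNesting 𝒩) (hN : N ∈ 𝒩) (hN' : N' ∈ 𝒩) (he : e ∈ N)
    (hf : f ∈ N') (hef : t.EdgeAdj e f) : N ⊆ N' ∨ N' ⊂ N := by
  by_cases hne : N = N'
  · exact Or.inl hne.subset
  rcases h.laminar N hN N' hN' hne with h1 | h1 | h1
  · exact Or.inl h1.subset
  · exact Or.inr h1
  · exact absurd hef (h.nonadjacent N hN N' hN' h1 e he f hf)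

theorem IsNesting.comparable_of_mem (h : t.IsNesting 𝒩) (hN : N ∈ 𝒩) (hN' : N' ∈ 𝒩) (he : e ∈ N)
    (he' : e ∈ N') : N ⊆ N' ∨ N' ⊂ N :=
  h.comparable hN hN' he he' (EdgeAdj.refl t e)

/-- The nests of a nesting with a property that implies that they contain `e` have a minimum. -/
theorem IsNesting.exists_minimum (h : t.IsNesting 𝒩) {p : Finset (Fin m) → Prop}
    (hp : ∀ N ∈ 𝒩, p N → e ∈ N) (hu : p Finset.univ) :
    ∃ N ∈ 𝒩, p N ∧ ∀ N' ∈ 𝒩, p N' → N ⊆ N' := by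
  classical
  obtain ⟨N, hN, hmin⟩ := (𝒩.filter p).exists_min_image Finset.card
    ⟨_, Finset.mem_filter.2 ⟨h.univ_mem e, hu⟩⟩
  simp only [Finset.mem_filter] at hN hmin
  refine ⟨N, hN.1, hN.2, fun N' hN' hpN' => ?_⟩
  rcases h.comparable_of_mem hN.1 hN' (hp _ hN.1 hN.2) (hp _ hN' hpN') with h1 | h1
  · exact h1
  · exact absurd (hmin N' ⟨hN', hpN'⟩) (not_le.2 (Finset.card_lt_card h1))

/-- The nests containing `e` form a chain, so the infimum defining `minNest` is attained; the chain
is not empty, since all edges together form a nest. -/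
theorem IsNesting.minNest_spec (h : t.IsNesting 𝒩) (e : Fin m) :
    minNest 𝒩 e ∈ 𝒩 ∧ e ∈ minNest 𝒩 e ∧ ∀ N ∈ 𝒩, e ∈ N → minNest 𝒩 e ⊆ N := by
  obtain ⟨N, hN, heN, hmin⟩ := h.exists_minimum (e := e) (p := fun N => e ∈ N)
    (fun _ _ h => h) (Finset.mem_univ e)
  have : minNest 𝒩 e = N := by
    apply le_antisymm
    · exact Finset.inf_le (f := id) (Finset.mem_filter.2 ⟨hN, heN⟩)
    · refine Finset.le_inf fun N' hN' => ?_
      exact hmin N' (Finset.mem_filter.1 hN').1 (Finset.mem_filter.1 hN').2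
  rw [this]
  exact ⟨hN, heN, hmin⟩

theorem IsNesting.minNest_mem (h : t.IsNesting 𝒩) (e : Fin m) : minNest 𝒩 e ∈ 𝒩 :=
  (h.minNest_spec e).1

theorem IsNesting.mem_minNest (h : t.IsNesting 𝒩) (e : Fin m) : e ∈ minNest 𝒩 e :=
  (h.minNest_spec e).2.1

theorem IsNesting.minNest_subset (h : t.IsNesting 𝒩) (hN : N ∈ 𝒩) (he : e ∈ N) :
    minNest 𝒩 e ⊆ N := (h.minNest_spec e).2.2 N hN he

theorem IsNesting.mem_iff_minNest_subset (h : t.IsNesting 𝒩) (hN : N ∈ 𝒩) :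
    e ∈ N ↔ minNest 𝒩 e ⊆ N :=
  ⟨h.minNest_subset hN, fun h' => h' (h.mem_minNest e)⟩

theorem IsNesting.minNest_eq (h : t.IsNesting 𝒩) (hN : N ∈ 𝒩) (he : e ∈ N)
    (hmin : ∀ N' ∈ 𝒩, e ∈ N' → N ⊆ N') : minNest 𝒩 e = N :=
  (h.minNest_subset hN he).antisymm (hmin _ (h.minNest_mem e) (h.mem_minNest e))

/-- A largest nest containing `e` among those with the property `p` contains all adjacent edges
whose smallest nest has the property `p`. -/
theorem IsNesting.exists_closed_part (h : t.IsNesting 𝒩) {p : Finset (Fin m) → Prop}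
    (he : ∃ N ∈ 𝒩, e ∈ N ∧ p N) :
    ∃ C ∈ 𝒩, e ∈ C ∧ p C ∧ ∀ a ∈ C, ∀ b, p (minNest 𝒩 b) → t.EdgeAdj a b → b ∈ C := by
  classical
  obtain ⟨N, hN, heN, hpN⟩ := he
  obtain ⟨C, hC, hmax⟩ := (𝒩.filter fun N => e ∈ N ∧ p N).exists_max_image Finset.card
    ⟨N, Finset.mem_filter.2 ⟨hN, heN, hpN⟩⟩
  simp only [Finset.mem_filter] at hC hmax
  refine ⟨C, hC.1, hC.2.1, hC.2.2, fun a ha b hb hab => ?_⟩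
  rcases h.comparable (h.minNest_mem b) hC.1 (h.mem_minNest b) ha hab.symm with h1 | h1
  · exact h1 (h.mem_minNest b)
  · exact absurd (hmax _ ⟨h.minNest_mem b, h1.subset hC.2.1, hb⟩)
      (not_le.2 (Finset.card_lt_card h1))

theorem IsNesting.minNest_ssubset_or_eq (h : t.IsNesting 𝒩) (hN : N ∈ 𝒩) (he : e ∈ N) :
    minNest 𝒩 e ⊂ N ∨ minNest 𝒩 e = N := by
  rcases eq_or_ne (minNest 𝒩 e) N with h1 | h1
  · exact Or.inr h1
  · exact Or.inl (Finset.ssubset_iff_subset_ne.2 ⟨h.minNest_subset hN he, h1⟩)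

/-- A connected subset of a nest `K` that is not contained in a proper subnest has an edge whose
smallest nest is `K`. -/
theorem IsNesting.exists_minNest_eq_of_nest (h : t.IsNesting 𝒩) (hK : K ∈ 𝒩) (hN : t.IsNest N)
    (hNK : N ⊆ K) (hmin : ∀ C ∈ 𝒩, N ⊆ C → K ⊆ C) : ∃ e ∈ N, minNest 𝒩 e = K := by
  -- Otherwise every edge of `N` lies in a nest properly inside `K`. A largest such nest through `g`
  -- is closed under adjacency in `N`, so it contains the connected `N`, against `hmin`.
  by_contra! hcon
  obtain ⟨g, hg⟩ := hN.1
  have hlt : ∀ e ∈ N, minNest 𝒩 e ⊂ K := fun e he =>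
    (h.minNest_ssubset_or_eq hK (hNK he)).resolve_right (hcon e he)
  obtain ⟨C, hC, hgC, hCK, hcl⟩ := h.exists_closed_part (e := g) (p := fun N => N ⊂ K)
    ⟨_, h.minNest_mem g, h.mem_minNest g, hlt g hg⟩
  have := hmin C hC (hN.subset_of_closed hg hgC fun a ha b hb hab => hcl a ha b (hlt b hb) hab)
  exact hCK.not_subset this

theorem IsNesting.exists_minNest_eq (h : t.IsNesting 𝒩) (hN : N ∈ 𝒩) :
    ∃ e ∈ N, minNest 𝒩 e = N :=
  h.exists_minNest_eq_of_nest hN (h.nest N hN) subset_rfl fun _ _ h => h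

theorem IsNesting.image_minNest (h : t.IsNesting 𝒩) : Finset.univ.image (minNest 𝒩) = 𝒩 := by
  ext N
  simp only [Finset.mem_image, Finset.mem_univ, true_and]
  constructor
  · rintro ⟨e, rfl⟩
    exact h.minNest_mem e
  · intro hN
    obtain ⟨e, -, he⟩ := h.exists_minNest_eq hN
    exact ⟨e, he⟩

theorem IsNesting.card_le (h : t.IsNesting 𝒩) : 𝒩.card ≤ m := by
  rw [← h.image_minNest]
  exact Finset.card_image_le.trans (by simp)

theorem IsNesting.injective_of_card (h : t.IsNesting 𝒩) (hc : 𝒩.card = m) :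
    Function.Injective (minNest 𝒩) := by
  have := Finset.card_image_iff.1 (show (Finset.univ.image (minNest 𝒩)).card = _ by
    rw [h.image_minNest, hc]; simp)
  exact fun a b hab => this (by simp) (by simp) hab

end Nesting

/-! ## The nesting of a function on the edges -/

section Superlevel

variable {w : Fin m → ℝ} {e f : Fin m}

open Classical in
/-- The connected component of `e` in the set of edges where `w` is at least `w e`. -/
noncomputable def superlevel (t : PT (m + 1)) (w : Fin m → ℝ) (e : Fin m) : Finset (Fin m) :=
  t.component (Finset.univ.filter fun f => w e ≤ w f) e

open Classical in
/-- The nesting that consists of the connected components of the superlevel sets of `w`. -/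
noncomputable def levelNesting (t : PT (m + 1)) (w : Fin m → ℝ) : Finset (Finset (Fin m)) :=
  Finset.univ.image (t.superlevel w)

theorem superlevel_mem_levelNesting (t : PT (m + 1)) (w : Fin m → ℝ) (e : Fin m) :
    t.superlevel w e ∈ t.levelNesting w :=
  Finset.mem_image_of_mem _ (Finset.mem_univ e)

theorem mem_levelNesting {N : Finset (Fin m)} :
    N ∈ t.levelNesting w ↔ ∃ e, t.superlevel w e = N := by
  simp [levelNesting]

theorem self_mem_superlevel (t : PT (m + 1)) (w : Fin m → ℝ) (e : Fin m) :
    e ∈ t.superlevel w e := self_mem_component (by simp)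

theorem isNest_superlevel (t : PT (m + 1)) (w : Fin m → ℝ) (e : Fin m) :
    t.IsNest (t.superlevel w e) := isNest_component (by simp)

theorem le_of_mem_superlevel (h : f ∈ t.superlevel w e) : w e ≤ w f := by
  simpa using (mem_component.1 h).1

theorem superlevel_closed {a b : Fin m} (ha : a ∈ t.superlevel w e) (hb : w e ≤ w b)
    (hab : t.EdgeAdj a b) : b ∈ t.superlevel w e :=
  component_closed ha (by simpa using hb) hab

theorem IsNest.subset_superlevel {N : Finset (Fin m)} (h : t.IsNest N) (he : e ∈ N)
    (hN : ∀ f ∈ N, w e ≤ w f) : N ⊆ t.superlevel w e :=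
  h.subset_component he fun f hf => by simpa using hN f hf

/-- A component of a superlevel set that meets or is adjacent to one of a lower level is contained
in it. -/
theorem superlevel_subset_of_adj {a b : Fin m} (ha : a ∈ t.superlevel w e)
    (hb : b ∈ t.superlevel w f) (hab : t.EdgeAdj a b) (hef : w e ≤ w f) :
    t.superlevel w f ⊆ t.superlevel w e :=
  (isNest_superlevel t w f).subset_of_closed hb
    (superlevel_closed ha (hef.trans (le_of_mem_superlevel hb)) hab)
    fun _ hx _ hy hxy => superlevel_closed hx (hef.trans (le_of_mem_superlevel hy)) hxy

theorem superlevel_subset (h : f ∈ t.superlevel w e) : t.superlevel w f ⊆ t.superlevel w e :=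
  superlevel_subset_of_adj h (self_mem_superlevel t w f) (EdgeAdj.refl t f)
    (le_of_mem_superlevel h)

theorem superlevel_eq (h : f ∈ t.superlevel w e) (hw : w f ≤ w e) :
    t.superlevel w f = t.superlevel w e :=
  (superlevel_subset h).antisymm
    (superlevel_subset_of_adj (self_mem_superlevel t w f) h (EdgeAdj.refl t f) hw)

/-- Components that meet or touch are comparable, the one of the higher level lying in the other;
this gives laminarity and non-adjacency at once. -/
theorem isNesting_levelNesting (t : PT (m + 1)) (w : Fin m → ℝ) :
    t.IsNesting (t.levelNesting w) := by
  have key : ∀ e f a b, a ∈ t.superlevel w e → b ∈ t.superlevel w f → t.EdgeAdj a b →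
      t.superlevel w e ⊆ t.superlevel w f ∨ t.superlevel w f ⊆ t.superlevel w e := by
    intro e f a b ha hb hab
    rcases le_total (w e) (w f) with h | h
    · exact Or.inr (superlevel_subset_of_adj ha hb hab h)
    · exact Or.inl (superlevel_subset_of_adj hb ha hab.symm h)
  refine ⟨?_, ?_, ?_, ?_⟩
  · intro N hN
    obtain ⟨e, rfl⟩ := mem_levelNesting.1 hN
    exact isNest_superlevel t w e
  · intro hm
    obtain ⟨e, -, he⟩ := Finset.univ.exists_min_image w ⟨⟨0, hm⟩, Finset.mem_univ _⟩
    refine mem_levelNesting.2 ⟨e, Finset.univ_subset_iff.1 ?_⟩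
    exact (t.isNest_univ hm).subset_superlevel (Finset.mem_univ e) he
  · intro N hN N' hN' hne
    obtain ⟨e, rfl⟩ := mem_levelNesting.1 hN
    obtain ⟨f, rfl⟩ := mem_levelNesting.1 hN'
    by_cases hd : Disjoint (t.superlevel w e) (t.superlevel w f)
    · exact Or.inr (Or.inr hd)
    · obtain ⟨a, ha, hb⟩ := Finset.not_disjoint_iff.1 hd
      rcases key e f a a ha hb (EdgeAdj.refl t a) with h | h
      · exact Or.inl (Finset.ssubset_iff_subset_ne.2 ⟨h, hne⟩)
      · exact Or.inr (Or.inl (Finset.ssubset_iff_subset_ne.2 ⟨h, hne.symm⟩))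
  · intro N hN N' hN' hd a ha b hb hab
    obtain ⟨e, rfl⟩ := mem_levelNesting.1 hN
    obtain ⟨f, rfl⟩ := mem_levelNesting.1 hN'
    rcases key e f a b ha hb hab with h | h
    · exact Finset.disjoint_left.1 hd (self_mem_superlevel t w e) (h (self_mem_superlevel t w e))
    · exact Finset.disjoint_left.1 hd (h (self_mem_superlevel t w f)) (self_mem_superlevel t w f)

theorem minNest_levelNesting (t : PT (m + 1)) (w : Fin m → ℝ) (e : Fin m) :
    minNest (t.levelNesting w) e = t.superlevel w e := by
  refine (isNesting_levelNesting t w).minNest_eq (superlevel_mem_levelNesting t w e)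
    (self_mem_superlevel t w e) fun N hN he => ?_
  obtain ⟨f, rfl⟩ := mem_levelNesting.1 hN
  exact superlevel_subset he

/-- For injective `w` an edge is recovered from its component as the unique edge where `w` is least.
-/
theorem card_levelNesting (t : PT (m + 1)) (hw : Function.Injective w) :
    (t.levelNesting w).card = m := by
  rw [levelNesting, Finset.card_image_of_injective, Finset.card_univ, Fintype.card_fin]
  intro e f h
  have h1 := le_of_mem_superlevel (h ▸ self_mem_superlevel t w e : e ∈ t.superlevel w f)
  have h2 := le_of_mem_superlevel (h.symm ▸ self_mem_superlevel t w f : f ∈ t.superlevel w e)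
  exact hw (le_antisymm h2 h1)

end Superlevel

/-! ## Maximal nestings -/

section Maximal

variable {𝒩 : Finset (Finset (Fin m))} {N : Finset (Fin m)} {e f : Fin m}

/-- The bound `m` on the number of nests is attained by the superlevel components of any injective
function. -/
theorem mem_maximalNestings : 𝒩 ∈ t.maximalNestings ↔ t.IsNesting 𝒩 ∧ 𝒩.card = m := by
  constructor
  · rintro ⟨h, hmax⟩
    refine ⟨h, le_antisymm h.card_le ?_⟩
    have hinj : Function.Injective fun i : Fin m => ((i : ℕ) : ℝ) := fun a b h => by
      simpa [Fin.ext_iff] using h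
    exact (card_levelNesting t hinj).symm.le.trans (hmax _ (isNesting_levelNesting t _))
  · rintro ⟨h, hc⟩
    exact ⟨h, fun 𝒩' h' => h'.card_le.trans hc.ge⟩

open Classical in
/-- Every nesting is contained in a maximal one in which a given edge is cut before the edges
with the same smallest nest. -/
theorem IsNesting.exists_maximal_superset (h : t.IsNesting 𝒩) (e₀ : Fin m) :
    ∃ 𝒩' ∈ t.maximalNestings, 𝒩 ⊆ 𝒩' ∧ minNest 𝒩' e₀ = minNest 𝒩 e₀ := by
  -- `u` numbers the edges with `e₀` first and `d` is the depth in `𝒩`. As `u < m`, the value `d * m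
  -- + u` orders edges by depth and then by `u`; its superlevel components are the maximal nesting
  -- sought.
  let u : Fin m → ℕ := fun e => Equiv.swap e₀ ⟨0, Nat.zero_lt_of_lt e₀.2⟩ e
  let d : Fin m → ℕ := fun e => (𝒩.filter fun N => e ∈ N).card
  let w' : Fin m → ℕ := fun e => d e * m + u e
  let w : Fin m → ℝ := fun e => w' e
  have hu : ∀ e, u e < m := fun e => Fin.is_lt _
  have hd : ∀ e f, w' e ≤ w' f → d e ≤ d f := by
    intro e f hle
    by_contra! hlt
    have h1 : (d f + 1) * m ≤ d e * m := Nat.mul_le_mul_right m hlt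
    have h2 := hu f
    have h3 : w' f = d f * m + u f := rfl
    have h4 : w' e = d e * m + u e := rfl
    nlinarith
  have hinj : Function.Injective w := by
    intro e f hef
    have hef : w' e = w' f := Nat.cast_injective (R := ℝ) hef
    have h1 : d e = d f := le_antisymm (hd e f hef.le) (hd f e hef.ge)
    have h2 : u e = u f := by
      have h3 : d e * m + u e = d f * m + u f := hef
      rw [h1] at h3
      omega
    exact (Equiv.swap _ _).injective (Fin.ext h2)
  have hlt : ∀ N ∈ 𝒩, ∀ e ∈ N, ∀ f, N ⊂ minNest 𝒩 f → d f < d e := by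
    intro N hN e he f hf
    refine Finset.card_lt_card (Finset.ssubset_iff_subset_ne.2 ⟨fun N' hN' => ?_, fun heq => ?_⟩)
    · simp only [Finset.mem_filter] at hN' ⊢
      exact ⟨hN'.1, h.minNest_subset hN'.1 hN'.2 (hf.subset he)⟩
    · have : N ∈ 𝒩.filter fun N => f ∈ N := by
        rw [heq]; exact Finset.mem_filter.2 ⟨hN, he⟩
      exact hf.not_subset (h.minNest_subset hN (Finset.mem_filter.1 this).2)
  have key : ∀ N ∈ 𝒩, ∀ e ∈ N, (∀ f ∈ N, w e ≤ w f) → t.superlevel w e = N := by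
    intro N hN e he hmin
    -- An edge outside `N` but adjacent to it has a smallest nest strictly larger than `N`, hence
    -- smaller depth, and is below the level of `e`.
    refine Finset.Subset.antisymm ?_ ((h.nest N hN).subset_superlevel he hmin)
    refine (isNest_superlevel t w e).subset_of_closed (self_mem_superlevel t w e) he
      fun a ha b hb hab => ?_
    have hwb : w' e ≤ w' b := Nat.cast_le.1 (le_of_mem_superlevel hb)
    rcases h.comparable (h.minNest_mem b) hN (h.mem_minNest b) ha hab.symm with h1 | h1
    · exact h1 (h.mem_minNest b)
    · exact absurd (hlt N hN e he b h1) (not_lt.2 (hd _ _ hwb))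
  refine ⟨t.levelNesting w, mem_maximalNestings.2 ⟨isNesting_levelNesting t w,
    card_levelNesting t hinj⟩, fun N hN => ?_, ?_⟩
  · obtain ⟨e, he, hmin⟩ := N.exists_min_image w (h.nest N hN).1
    exact mem_levelNesting.2 ⟨e, key N hN e he hmin⟩
  · rw [minNest_levelNesting]
    refine key _ (h.minNest_mem e₀) e₀ (h.mem_minNest e₀) fun f hf => ?_
    have hdf : d e₀ ≤ d f := by
      refine Finset.card_le_card fun N' hN' => ?_
      simp only [Finset.mem_filter] at hN' ⊢
      exact ⟨hN'.1, h.minNest_subset hN'.1 hN'.2 hf⟩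
    have h0 : u e₀ = 0 := by simp [u]
    have : w' e₀ ≤ w' f := Nat.add_le_add (Nat.mul_le_mul_right m hdf) (h0 ▸ Nat.zero_le _)
    exact Nat.cast_le.2 this

theorem IsNesting.exists_maximal (h : t.IsNesting 𝒩) : ∃ 𝒩' ∈ t.maximalNestings, 𝒩 ⊆ 𝒩' := by
  rcases Nat.eq_zero_or_pos m with rfl | hm
  · exact ⟨𝒩, mem_maximalNestings.2 ⟨h, le_antisymm h.card_le (Nat.zero_le _)⟩, subset_rfl⟩
  · obtain ⟨𝒩', h1, h2, -⟩ := h.exists_maximal_superset ⟨0, hm⟩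
    exact ⟨𝒩', h1, h2⟩

/-- Choose `e₀` in `N` whose smallest nest is largest, and extend `𝒩` without changing that nest. If
the extension contained `N`, the nest would lie in `N`; the choice of `e₀` gives the converse
inclusion, so `N` would already belong to `𝒩`. -/
theorem IsNesting.exists_maximal_notMem (h : t.IsNesting 𝒩) (hN : t.IsNest N) (hN' : N ∉ 𝒩) :
    ∃ 𝒩' ∈ t.maximalNestings, 𝒩 ⊆ 𝒩' ∧ N ∉ 𝒩' := by
  obtain ⟨e₀, he₀, hmax⟩ := N.exists_max_image (fun e => (minNest 𝒩 e).card) hN.1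
  obtain ⟨𝒩', h', hsub, heq⟩ := h.exists_maximal_superset e₀
  refine ⟨𝒩', h', hsub, fun hmem => hN' ?_⟩
  have hn' := (mem_maximalNestings.1 h').1
  have h1 : minNest 𝒩 e₀ ⊆ N := heq ▸ hn'.minNest_subset hmem he₀
  suffices N ⊆ minNest 𝒩 e₀ by
    rw [this.antisymm h1]
    exact h.minNest_mem e₀
  refine hN.subset_of_closed he₀ (h.mem_minNest e₀) fun a ha b hb hab => ?_
  rcases h.comparable (h.minNest_mem b) (h.minNest_mem e₀) (h.mem_minNest b) ha hab.symm with
    h2 | h2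
  · exact h2 (h.mem_minNest b)
  · exact absurd (hmax b hb) (not_le.2 (Finset.card_lt_card h2))

end Maximal

/-! ## Linear forms as combinations of nests -/

section Decomposition

variable {𝒩 : Finset (Finset (Fin m))} {N : Finset (Fin m)} {w : Fin m → ℝ}

open Classical in
/-- Möbius inversion on the nests of a nesting. -/
theorem IsNesting.exists_sum_eq (h : t.IsNesting 𝒩)
    (hw : ∀ e f, minNest 𝒩 e ⊂ minNest 𝒩 f → w f < w e)
    (hw' : ∀ e f, minNest 𝒩 e = minNest 𝒩 f → w f = w e) :
    ∃ c : Finset (Fin m) → ℝ, (∀ N ∈ 𝒩, N ≠ Finset.univ → 0 < c N) ∧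
      ∀ e, w e = ∑ N ∈ 𝒩.filter fun N => e ∈ N, c N := by
  have hex : ∀ N : Finset (Fin m), ∃ p : Finset (Fin m), N ∈ 𝒩 → N ≠ Finset.univ →
      p ∈ 𝒩 ∧ N ⊂ p ∧ ∀ N' ∈ 𝒩, N ⊂ N' → p ⊆ N' := by
    intro N
    by_cases hN : N ∈ 𝒩
    · by_cases hu : N = Finset.univ
      · exact ⟨N, fun _ h => absurd hu h⟩
      · obtain ⟨e, he⟩ := (h.nest N hN).1
        obtain ⟨p, hp⟩ := h.exists_minimum (e := e) (p := fun N' => N ⊂ N')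
          (fun N' _ h' => h'.subset he) (Finset.ssubset_univ_iff.2 hu)
        exact ⟨p, fun _ _ => hp⟩
    · exact ⟨N, fun h => absurd h hN⟩
  choose p hp using hex
  have hex : ∀ N : Finset (Fin m), ∃ r : ℝ, N ∈ 𝒩 → ∀ e, minNest 𝒩 e = N → w e = r := by
    intro N
    by_cases hN : N ∈ 𝒩
    · obtain ⟨e, -, he⟩ := h.exists_minNest_eq hN
      exact ⟨w e, fun _ f hf => hw' e f (he.trans hf.symm)⟩
    · exact ⟨0, fun h => absurd h hN⟩
  choose r hr using hex
  -- `r N` is the value of `w` on the edges with smallest nest `N`, and `p N` is the next larger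
  -- nest; the sum of `c` over the nests containing `N` telescopes to `r N`.
  let c : Finset (Fin m) → ℝ := fun N => if N = Finset.univ then r N else r N - r (p N)
  have key : ∀ k, ∀ N ∈ 𝒩, m - N.card ≤ k → ∑ N' ∈ 𝒩.filter fun N' => N ⊆ N', c N' = r N := by
    intro k
    induction k with
    | zero =>
      intro N hN hk
      have hu : N = Finset.univ := by
        rw [← Finset.card_eq_iff_eq_univ, Fintype.card_fin]
        exact le_antisymm (by simpa using Finset.card_le_univ N) (by omega)
      subst hu
      have : (𝒩.filter fun N' => Finset.univ ⊆ N') = {Finset.univ} := by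
        ext N'
        simp only [Finset.mem_filter, Finset.univ_subset_iff, Finset.mem_singleton]
        exact ⟨fun h => h.2, fun h => ⟨h ▸ hN, h⟩⟩
      rw [this, Finset.sum_singleton]
      exact if_pos rfl
    | succ k ih =>
      intro N hN hk
      by_cases hu : N = Finset.univ
      · exact ih N hN (by subst hu; simp)
      · obtain ⟨hp1, hp2, hp3⟩ := hp N hN hu
        have : (𝒩.filter fun N' => N ⊆ N') = insert N (𝒩.filter fun N' => p N ⊆ N') := by
          ext N'
          simp only [Finset.mem_filter, Finset.mem_insert]
          constructor
          · rintro ⟨h1, h2⟩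
            rcases eq_or_ne N N' with h3 | h3
            · exact Or.inl h3.symm
            · exact Or.inr ⟨h1, hp3 N' h1 (Finset.ssubset_iff_subset_ne.2 ⟨h2, h3⟩)⟩
          · rintro (rfl | ⟨h1, h2⟩)
            · exact ⟨hN, subset_rfl⟩
            · exact ⟨h1, hp2.subset.trans h2⟩
        have hlt := Finset.card_lt_card hp2
        rw [this, Finset.sum_insert fun h => hp2.not_subset (Finset.mem_filter.1 h).2,
          ih (p N) hp1 (by omega)]
        simp [c, hu]
  refine ⟨c, fun N hN hu => ?_, fun e => ?_⟩
  · obtain ⟨hp1, hp2, -⟩ := hp N hN hu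
    obtain ⟨e, -, he⟩ := h.exists_minNest_eq hN
    obtain ⟨f, -, hf⟩ := h.exists_minNest_eq hp1
    simp only [c, if_neg hu, sub_pos]
    rw [← hr N hN e he, ← hr _ hp1 f hf]
    exact hw e f (by rw [he, hf]; exact hp2)
  · rw [hr _ (h.minNest_mem e) e rfl, ← key _ _ (h.minNest_mem e) le_rfl]
    refine Finset.sum_congr (Finset.filter_congr fun N hN => ?_) fun _ _ => rfl
    exact (h.mem_iff_minNest_subset hN).symm

open Classical in
-- For superlevel components, equal components have equal levels and a strictly smaller component
-- has a strictly higher level, as Möbius inversion requires.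
theorem exists_nesting_sum_eq (t : PT (m + 1)) (w : Fin m → ℝ) :
    ∃ 𝒩, t.IsNesting 𝒩 ∧ ∃ c : Finset (Fin m) → ℝ, (∀ N ∈ 𝒩, N ≠ Finset.univ → 0 < c N) ∧
      ∀ e, w e = ∑ N ∈ 𝒩.filter fun N => e ∈ N, c N := by
  refine ⟨t.levelNesting w, isNesting_levelNesting t w,
    (isNesting_levelNesting t w).exists_sum_eq ?_ ?_⟩
  · intro e f h
    rw [minNest_levelNesting, minNest_levelNesting] at h
    by_contra! hle
    exact h.ne (superlevel_eq (h.subset (self_mem_superlevel t w e)) hle)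
  · intro e f h
    rw [minNest_levelNesting, minNest_levelNesting] at h
    exact le_antisymm (le_of_mem_superlevel (h ▸ self_mem_superlevel t w e))
      (le_of_mem_superlevel (h ▸ self_mem_superlevel t w f))

end Decomposition

end Operahedra.PT

namespace Operahedra.PT

variable {m : ℕ} {t : PT (m + 1)}

/-! ## Loday points -/

section Separation

variable {𝒩 : Finset (Finset (Fin m))} {N K : Finset (Fin m)} {e f i j : Fin m}
  {x y : Fin (m + 1)}

/-- In a maximal nesting, an edge `e` of a nest other than the one where the nest is cut lies in
a smaller nest that is closed under adjacency. -/
theorem exists_part (h : 𝒩 ∈ t.maximalNestings) (he : e ∈ minNest 𝒩 i) (hei : e ≠ i) :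
    ∃ C ∈ 𝒩, e ∈ C ∧ C ⊂ minNest 𝒩 i ∧
      ∀ a ∈ C, ∀ b ∈ (minNest 𝒩 i).erase i, t.EdgeAdj a b → b ∈ C := by
  obtain ⟨hn, hc⟩ := mem_maximalNestings.1 h
  have hlt : ∀ b ∈ (minNest 𝒩 i).erase i, minNest 𝒩 b ⊂ minNest 𝒩 i := fun b hb =>
    (hn.minNest_ssubset_or_eq (hn.minNest_mem i) (Finset.mem_of_mem_erase hb)).resolve_right
      fun h => Finset.ne_of_mem_erase hb (hn.injective_of_card hc h)
  obtain ⟨C, hC, heC, hCK, hcl⟩ := hn.exists_closed_part (e := e) (p := fun N => N ⊂ minNest 𝒩 i)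
    ⟨_, hn.minNest_mem e, hn.mem_minNest e, hlt e (Finset.mem_erase.2 ⟨hei, he⟩)⟩
  exact ⟨C, hC, heC, hCK, fun a ha b hb hab => hcl a ha b (hlt b hb) hab⟩

/-- The vertices `x` and `y` belong to different parts of the smallest nest containing `i`, when
it is cut at `i`. -/
def Separates (t : PT (m + 1)) (𝒩 : Finset (Finset (Fin m))) (i : Fin m) (x y : Fin (m + 1)) :
    Prop :=
  t.Reach (minNest 𝒩 i) x y ∧ ¬ t.Reach ((minNest 𝒩 i).erase i) x y

theorem Separates.ne (h : t.Separates 𝒩 i x y) : x ≠ y := by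
  rintro rfl
  exact h.2 (Reach.refl ..)

/-- Take the smallest nest of `𝒩` connecting `x` and `y`, and its cut edge `i`: without `i` the two
would be connected inside a smaller nest. -/
theorem exists_separates (h : 𝒩 ∈ t.maximalNestings) (hN : t.Reach N x y) (hxy : x ≠ y) :
    ∃ i ∈ N, t.Separates 𝒩 i x y := by
  classical
  obtain ⟨hn, hc⟩ := mem_maximalNestings.1 h
  obtain ⟨e, -, -⟩ := hN.exists_first_edge hxy
  obtain ⟨K, hK, hmin⟩ := (𝒩.filter fun K => t.Reach K x y).exists_min_image Finset.card
    ⟨_, Finset.mem_filter.2 ⟨hn.univ_mem e, t.reach_univ x y⟩⟩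
  simp only [Finset.mem_filter] at hK hmin
  obtain ⟨i, -, rfl⟩ := hn.exists_minNest_eq hK.1
  have hnr : ¬ t.Reach ((minNest 𝒩 i).erase i) x y := by
    intro hr
    obtain ⟨g, hg, hgx⟩ := hr.exists_first_edge hxy
    obtain ⟨C, hC, hgC, hCK, hcl⟩ := exists_part h (Finset.mem_of_mem_erase hg)
      (Finset.ne_of_mem_erase hg)
    exact absurd (hmin C ⟨hC, (hr.mem_of_closed hgC hgx hcl).1⟩)
      (not_le.2 (Finset.card_lt_card hCK))
  refine ⟨i, ?_, hK.2, hnr⟩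
  -- In a tree, `i` separates `x` from `y` globally, so every path between them uses `i`.
  by_contra hiN
  have hr : t.Reach (Finset.univ.erase i) x y := hN.mono fun e he =>
    Finset.mem_erase.2 ⟨fun h => hiN (h ▸ he), Finset.mem_univ e⟩
  have hle : (minNest 𝒩 i).erase i ⊆ Finset.univ.erase i :=
    Finset.erase_subset_erase i (Finset.subset_univ _)
  refine ((separated_iff (Finset.mem_univ i)).2 ?_).2 hr
  rcases (separated_iff (hn.mem_minNest i)).1 ⟨hK.2, hnr⟩ with h1 | h1
  · exact Or.inl ⟨h1.1.mono hle, h1.2.mono hle⟩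
  · exact Or.inr ⟨h1.1.mono hle, h1.2.mono hle⟩

/-- The smallest nests of `i` and `j` both have an edge at `x`, so they are comparable. Were one
properly inside the other, it would connect `x` and `y` without the cut edge of the larger one. -/
theorem Separates.eq (h : 𝒩 ∈ t.maximalNestings) (hi : t.Separates 𝒩 i x y)
    (hj : t.Separates 𝒩 j x y) : i = j := by
  obtain ⟨hn, hc⟩ := mem_maximalNestings.1 h
  have key : ∀ i j, t.Separates 𝒩 i x y → t.Separates 𝒩 j x y →
      ¬ minNest 𝒩 i ⊂ minNest 𝒩 j := by
    intro i j hi hj hlt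
    refine hj.2 (hi.1.mono fun e he => Finset.mem_erase.2 ⟨?_, hlt.subset he⟩)
    rintro rfl
    exact hlt.not_subset (hn.minNest_subset (hn.minNest_mem i) he)
  obtain ⟨e, he, hex⟩ := hi.1.exists_first_edge hi.ne
  obtain ⟨f, hf, hfx⟩ := hj.1.exists_first_edge hi.ne
  refine hn.injective_of_card hc ?_
  rcases hn.comparable (hn.minNest_mem i) (hn.minNest_mem j) he hf ⟨x, hex, hfx⟩ with h1 | h1
  · by_contra hne
    exact key i j hi hj (Finset.ssubset_iff_subset_ne.2 ⟨h1, hne⟩)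
  · exact absurd h1 (key j i hj hi)

/-- This pair makes the inequality for `N` strict. The smallest nest of `𝒩` containing `N` is cut at
some `i ∈ N` and has an edge `b ∉ N` touching `N`. The far end of `b` and the end of `i` on the
other side of the cut are separated at `i` but not connected by `N`. -/
theorem exists_separates_not_reach (h : 𝒩 ∈ t.maximalNestings) (hN : t.IsNest N) (hN' : N ∉ 𝒩) :
    ∃ i ∈ N, ∃ x y, t.Separates 𝒩 i x y ∧ ¬ t.Reach N x y := by
  obtain ⟨hn, hc⟩ := mem_maximalNestings.1 h
  obtain ⟨e, he⟩ := hN.1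
  obtain ⟨K, hK, hNK, hmin⟩ := hn.exists_minimum (e := e) (p := fun K => N ⊆ K)
    (fun _ _ h => h he) (Finset.subset_univ N)
  obtain ⟨i, hiN, rfl⟩ := hn.exists_minNest_eq_of_nest hK hN hNK hmin
  have hne : ¬ minNest 𝒩 i ⊆ N := fun h => hN' (h.antisymm hNK ▸ hK)
  obtain ⟨a, ha, b, hb, hbN, z, haz, hbz⟩ := (hn.nest _ hK).exists_adj (hNK hiN) hiN hne
  obtain ⟨z', hbz', hzz'⟩ : ∃ z', t.Incident b z' ∧ ¬ t.Reach N z' z := by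
    have := not_reach_of_notMem (t := t) hbN
    rcases hbz with rfl | rfl
    · exact ⟨_, t.incident_tgt b, fun h => this h.symm⟩
    · exact ⟨_, t.incident_src b, this⟩
  refine ⟨i, hiN, ?_⟩
  have hr : t.Reach (minNest 𝒩 i) (t.src i) z' := (hn.nest _ hK).reach (hn.mem_minNest i) hb
    (t.incident_src i) hbz'
  have hz : ∀ y, t.Incident i y → ¬ t.Reach N z' y := fun y hy h' =>
    hzz' (h'.trans (hN.reach hiN ha hy haz))
  rcases (reach_src_iff (hn.mem_minNest i)).1 hr with h1 | h1
  · exact ⟨z', t.tgt i, (separated_iff (hn.mem_minNest i)).2 (Or.inr ⟨h1, Reach.refl ..⟩),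
      hz _ (t.incident_tgt i)⟩
  · exact ⟨z', t.src i, (separated_iff (hn.mem_minNest i)).2 (Or.inl ⟨h1, Reach.refl ..⟩),
      hz _ (t.incident_src i)⟩

end Separation

-- Coordinate sums of Loday points as weighted counts of separated pairs.

section Sums

variable {𝒩 : Finset (Finset (Fin m))} {N : Finset (Fin m)} {ω : Fin (m + 1) → ℕ+}

/-- The product of the weights of two vertices. -/
def pairWeight (ω : Fin (m + 1) → ℕ+) (q : Fin (m + 1) × Fin (m + 1)) : ℝ :=
  ((ω q.1 : ℕ) : ℝ) * ((ω q.2 : ℕ) : ℝ)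

theorem pairWeight_pos (ω : Fin (m + 1) → ℕ+) (q : Fin (m + 1) × Fin (m + 1)) :
    0 < pairWeight ω q := mul_pos (Nat.cast_pos.2 (ω q.1).pos) (Nat.cast_pos.2 (ω q.2).pos)

open Classical in
/-- The sum of `ω_x ω_y` over all sets `{x, y}` of two vertices connected by the edges in `N`. -/
noncomputable def bound (t : PT (m + 1)) (ω : Fin (m + 1) → ℕ+) (N : Finset (Fin m)) : ℝ :=
  (∑ q : Fin (m + 1) × Fin (m + 1),
    if q.1 ≠ q.2 ∧ t.Reach N q.1 q.2 then pairWeight ω q else 0) / 2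

theorem ite_add_ite_of_not_and {A B : Prop} [Decidable A] [Decidable B] [Decidable (A ∨ B)]
    (r : ℝ) (h : ¬ (A ∧ B)) :
    (if A then r else 0) + (if B then r else 0) = if A ∨ B then r else 0 := by
  by_cases hA : A <;> by_cases hB : B <;> simp_all

open Classical in
-- Expanding `α_i β_i` counts every pair with one vertex on each side of the cut; the sum over
-- ordered pairs counts it twice.
theorem two_mul_lodayPoint (h : t.IsNesting 𝒩) (ω : Fin (m + 1) → ℕ+) (i : Fin m) :
    2 * t.lodayPoint ω 𝒩 i = ∑ q : Fin (m + 1) × Fin (m + 1),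
      if t.Separates 𝒩 i q.1 q.2 then pairWeight ω q else 0 := by
  have hprod : ∀ (p q : Fin (m + 1) → Prop) [DecidablePred p] [DecidablePred q],
      (∑ x ∈ Finset.univ.filter p, ((ω x : ℕ) : ℝ)) * ∑ y ∈ Finset.univ.filter q, ((ω y : ℕ) : ℝ) =
      ∑ z : Fin (m + 1) × Fin (m + 1), if p z.1 ∧ q z.2 then pairWeight ω z else 0 := by
    intro p q _ _
    rw [Finset.sum_filter, Finset.sum_filter, Finset.sum_mul_sum, ← Finset.univ_product_univ,
      Finset.sum_product]
    refine Finset.sum_congr rfl fun x _ => Finset.sum_congr rfl fun y _ => ?_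
    by_cases h1 : p x <;> by_cases h2 : q y <;> simp [h1, h2, pairWeight]
  have h1 : t.lodayPoint ω 𝒩 i = t.alpha ω 𝒩 i * t.beta ω 𝒩 i := rfl
  have h2 : t.lodayPoint ω 𝒩 i = t.beta ω 𝒩 i * t.alpha ω 𝒩 i := by rw [h1, mul_comm]
  rw [two_mul]
  nth_rewrite 1 [h1]
  rw [h2, alpha, beta, hprod, hprod, ← Finset.sum_add_distrib]
  refine Finset.sum_congr rfl fun q _ => ?_
  have hs : t.Separates 𝒩 i q.1 q.2 ↔ _ := separated_iff (h.mem_minNest i)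
  have hn : ¬ t.Reach ((minNest 𝒩 i).erase i) (t.src i) (t.tgt i) :=
    not_reach_of_notMem (Finset.notMem_erase i _)
  have hc : ∀ x y, (t.cutGraph 𝒩 i).Reachable x y ↔ t.Reach ((minNest 𝒩 i).erase i) x y :=
    fun _ _ => Iff.rfl
  simp only [hs, hc]
  exact ite_add_ite_of_not_and _ fun h => hn (h.2.1.trans h.1.1.symm)

open Classical in
theorem two_mul_sum_lodayPoint (h : t.IsNesting 𝒩) (ω : Fin (m + 1) → ℕ+) (N : Finset (Fin m)) :
    2 * ∑ i ∈ N, t.lodayPoint ω 𝒩 i = ∑ q : Fin (m + 1) × Fin (m + 1),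
      ((N.filter fun i => t.Separates 𝒩 i q.1 q.2).card : ℝ) * pairWeight ω q := by
  rw [Finset.mul_sum, Finset.sum_congr rfl fun i _ => two_mul_lodayPoint h ω i, Finset.sum_comm]
  refine Finset.sum_congr rfl fun q _ => ?_
  rw [← Finset.sum_filter, Finset.sum_const, nsmul_eq_mul]

theorem two_mul_bound (t : PT (m + 1)) (ω : Fin (m + 1) → ℕ+) (N : Finset (Fin m)) [∀ q :
    Fin (m + 1) × Fin (m + 1), Decidable (q.1 ≠ q.2 ∧ t.Reach N q.1 q.2)] :
    2 * t.bound ω N = ∑ q : Fin (m + 1) × Fin (m + 1),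
      (if q.1 ≠ q.2 ∧ t.Reach N q.1 q.2 then 1 else 0 : ℝ) * pairWeight ω q := by
  rw [bound, mul_div_cancel₀ _ two_ne_zero]
  refine Finset.sum_congr rfl fun q _ => ?_
  split_ifs <;> simp

open Classical in
theorem reach_le_card (h : 𝒩 ∈ t.maximalNestings) (N : Finset (Fin m))
    (q : Fin (m + 1) × Fin (m + 1)) :
    (if q.1 ≠ q.2 ∧ t.Reach N q.1 q.2 then 1 else 0 : ℝ) ≤
      ((N.filter fun i => t.Separates 𝒩 i q.1 q.2).card : ℝ) := by
  split_ifs with hq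
  · obtain ⟨i, hi, hs⟩ := exists_separates h hq.2 hq.1
    exact Nat.one_le_cast.2 (Finset.card_pos.2 ⟨i, Finset.mem_filter.2 ⟨hi, hs⟩⟩)
  · exact Nat.cast_nonneg _

theorem bound_le_sum (h : 𝒩 ∈ t.maximalNestings) (ω : Fin (m + 1) → ℕ+) (N : Finset (Fin m)) :
    t.bound ω N ≤ ∑ i ∈ N, t.lodayPoint ω 𝒩 i := by
  classical
  suffices 2 * t.bound ω N ≤ 2 * ∑ i ∈ N, t.lodayPoint ω 𝒩 i by linarith
  rw [two_mul_bound, two_mul_sum_lodayPoint (mem_maximalNestings.1 h).1]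
  exact Finset.sum_le_sum fun q _ =>
    mul_le_mul_of_nonneg_right (reach_le_card h N q) (pairWeight_pos ω q).le

theorem bound_lt_sum (h : 𝒩 ∈ t.maximalNestings) (ω : Fin (m + 1) → ℕ+) (hN : t.IsNest N)
    (hN' : N ∉ 𝒩) : t.bound ω N < ∑ i ∈ N, t.lodayPoint ω 𝒩 i := by
  classical
  suffices 2 * t.bound ω N < 2 * ∑ i ∈ N, t.lodayPoint ω 𝒩 i by linarith
  rw [two_mul_bound, two_mul_sum_lodayPoint (mem_maximalNestings.1 h).1]
  obtain ⟨i, hi, x, y, hs, hnr⟩ := exists_separates_not_reach h hN hN'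
  refine Finset.sum_lt_sum (fun q _ => mul_le_mul_of_nonneg_right (reach_le_card h N q)
    (pairWeight_pos ω q).le) ⟨(x, y), Finset.mem_univ _, ?_⟩
  refine mul_lt_mul_of_pos_right ?_ (pairWeight_pos ω _)
  rw [if_neg fun h => hnr h.2]
  exact Nat.cast_pos.2 (Finset.card_pos.2 ⟨i, Finset.mem_filter.2 ⟨hi, hs⟩⟩)

/-- A pair is separated at most once, and a pair separated at `i ∈ N` is connected by `minNest 𝒩 i`,
which lies in `N`; so the counts agree pair by pair. -/
theorem sum_eq_bound (h : 𝒩 ∈ t.maximalNestings) (ω : Fin (m + 1) → ℕ+) (hN : N ∈ 𝒩) :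
    ∑ i ∈ N, t.lodayPoint ω 𝒩 i = t.bound ω N := by
  classical
  have hn := (mem_maximalNestings.1 h).1
  suffices 2 * ∑ i ∈ N, t.lodayPoint ω 𝒩 i = 2 * t.bound ω N by linarith
  rw [two_mul_bound, two_mul_sum_lodayPoint hn]
  refine Finset.sum_congr rfl fun q _ => congrArg (· * _) (le_antisymm ?_ (reach_le_card h N q))
  split_ifs with hq
  · refine Nat.cast_le_one.2 (Finset.card_le_one.2 fun i hi j hj => ?_)
    exact Separates.eq h (Finset.mem_filter.1 hi).2 (Finset.mem_filter.1 hj).2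
  · refine (Nat.cast_eq_zero.2 (Finset.card_eq_zero.2 ?_)).le
    refine Finset.filter_eq_empty_iff.2 fun i hi hs => hq ⟨hs.ne, hs.1.mono ?_⟩
    exact hn.minNest_subset hN hi

theorem sum_eq_bound_iff (h : 𝒩 ∈ t.maximalNestings) (ω : Fin (m + 1) → ℕ+) (hN : t.IsNest N) :
    ∑ i ∈ N, t.lodayPoint ω 𝒩 i = t.bound ω N ↔ N ∈ 𝒩 :=
  ⟨fun h' => by
    by_contra hN'
    exact (bound_lt_sum h ω hN hN').ne' h', sum_eq_bound h ω⟩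

end Sums

end Operahedra.PT

namespace Operahedra.PT

variable {m : ℕ} {t : PT (m + 1)}

/-! ## Loday polytopes as polyhedra -/

section Polyhedron

variable {𝒩 𝒩' : Finset (Finset (Fin m))} {N : Finset (Fin m)} {ω : Fin (m + 1) → ℕ+} {x y d : E m}

/-- The sum of the coordinates with index in `N`. -/
noncomputable def edgeSum (N : Finset (Fin m)) : E m →L[ℝ] ℝ :=
  ∑ i ∈ N, EuclideanSpace.proj i

theorem edgeSum_apply (N : Finset (Fin m)) (x : E m) : edgeSum N x = ∑ i ∈ N, x i := by
  simp [edgeSum]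

theorem lodayPoint_mem (h : 𝒩 ∈ t.maximalNestings) (ω : Fin (m + 1) → ℕ+) :
    t.lodayPoint ω 𝒩 ∈ t.lodayPolytope ω :=
  subset_convexHull ℝ _ ⟨𝒩, h, rfl⟩

theorem convex_lodayPolytope (t : PT (m + 1)) (ω : Fin (m + 1) → ℕ+) :
    Convex ℝ (t.lodayPolytope ω) := convex_convexHull ℝ _

theorem isCompact_lodayPolytope (t : PT (m + 1)) (ω : Fin (m + 1) → ℕ+) :
    IsCompact (t.lodayPolytope ω) :=
  ((Set.toFinite t.maximalNestings).image _).isCompact_convexHull (𝕜 := ℝ)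

theorem bound_le_edgeSum (hx : x ∈ t.lodayPolytope ω) (N : Finset (Fin m)) :
    t.bound ω N ≤ edgeSum N x := by
  refine convexHull_min (t := {x | t.bound ω N ≤ edgeSum N x}) ?_
    (convex_halfSpace_ge (edgeSum N).isLinear _) hx
  rintro _ ⟨𝒩, h, rfl⟩
  rw [Set.mem_ofPred_eq, edgeSum_apply]
  exact bound_le_sum h ω N

/-- The nests whose inequality is an equality at a point of the polytope belong to a common
maximal nesting. -/
theorem exists_maximal_of_mem (hx : x ∈ t.lodayPolytope ω) :
    ∃ 𝒩 ∈ t.maximalNestings, ∀ N, t.IsNest N → edgeSum N x = t.bound ω N → N ∈ 𝒩 := by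
  obtain ⟨ι, _, w, z, hw, hw1, hz, rfl⟩ := mem_convexHull_iff_exists_fintype.1 hx
  obtain ⟨i, hi⟩ : ∃ i, 0 < w i := by
    by_contra! hcon
    have := Finset.sum_nonpos fun i (_ : i ∈ Finset.univ) => hcon i
    linarith
  obtain ⟨𝒩, h𝒩, hzi⟩ := hz i
  refine ⟨𝒩, h𝒩, fun N hN heq => (sum_eq_bound_iff h𝒩 ω hN).1 ?_⟩
  -- A convex combination of non-negative slacks vanishes, so the slack is zero at each vertex of
  -- positive weight.
  have h0 : ∑ j, w j * (edgeSum N (z j) - t.bound ω N) = 0 := by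
    simp only [mul_sub, Finset.sum_sub_distrib, ← Finset.sum_mul, hw1, one_mul, ← heq, map_sum,
      map_smul, smul_eq_mul, sub_self]
  have h1 := (Finset.sum_eq_zero_iff_of_nonneg fun j _ => mul_nonneg (hw j) (sub_nonneg.2
    (bound_le_edgeSum (subset_convexHull ℝ _ (hz j)) N))).1 h0 i (Finset.mem_univ i)
  rw [← edgeSum_apply, hzi]
  exact sub_eq_zero.1 ((mul_eq_zero.1 h1).resolve_left hi.ne')

theorem edgeSum_univ (hx : x ∈ t.lodayPolytope ω) (hm : 0 < m) :
    edgeSum Finset.univ x = t.bound ω Finset.univ := by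
  refine convexHull_min (t := {x | edgeSum Finset.univ x = t.bound ω Finset.univ}) ?_
    (convex_hyperplane (edgeSum Finset.univ).isLinear _) hx
  rintro _ ⟨𝒩, h, rfl⟩
  rw [Set.mem_ofPred_eq, edgeSum_apply]
  exact sum_eq_bound h ω ((mem_maximalNestings.1 h).1.trivial_mem hm)

/-- A linear form as a combination of the sums over the nests of a nesting. -/
theorem exists_nesting_linear_eq (t : PT (m + 1)) (l : E m →L[ℝ] ℝ) :
    ∃ 𝒩, t.IsNesting 𝒩 ∧ ∃ c : Finset (Fin m) → ℝ, (∀ N ∈ 𝒩, N ≠ Finset.univ → 0 < c N) ∧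
      ∀ x, l x = ∑ N ∈ 𝒩, c N * edgeSum N x := by
  classical
  obtain ⟨𝒩, h, c, hc, hw⟩ := exists_nesting_sum_eq t
    ((InnerProductSpace.toDual ℝ (E m)).symm l)
  refine ⟨𝒩, h, c, hc, fun x => ?_⟩
  rw [← InnerProductSpace.toDual_symm_apply, PiLp.inner_apply]
  have h1 : ∀ N, c N * edgeSum N x = ∑ i, if i ∈ N then c N * x i else 0 := fun N => by
    rw [edgeSum_apply, Finset.mul_sum, Finset.sum_ite_mem, Finset.univ_inter]
  rw [Finset.sum_congr rfl fun N _ => h1 N, Finset.sum_comm]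
  refine Finset.sum_congr rfl fun i _ => ?_
  rw [← Finset.sum_filter, ← Finset.sum_mul, ← hw i]
  exact mul_comm _ _

/-- A linear form separating `x` from the polytope would be smaller at `x` than at the vertex of a
maximal nesting that contains the nesting of the form. But at that vertex every nest sum in the
expansion of the form is as small as the inequalities allow. -/
theorem mem_lodayPolytope (h : ∀ N, t.IsNest N → t.bound ω N ≤ edgeSum N x)
    (hu : 0 < m → edgeSum Finset.univ x = t.bound ω Finset.univ) : x ∈ t.lodayPolytope ω := by
  by_contra hx
  obtain ⟨l, a, hl, ha⟩ := geometric_hahn_banach_point_closed (t.convex_lodayPolytope ω)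
    (t.isCompact_lodayPolytope ω).isClosed hx
  obtain ⟨𝒩, hn, c, hc, hlc⟩ := exists_nesting_linear_eq t l
  obtain ⟨ℳ, hℳ, hsub⟩ := hn.exists_maximal
  have h1 := ha _ (lodayPoint_mem hℳ ω)
  refine absurd (hl.trans h1) (not_lt.2 ?_)
  rw [hlc, hlc]
  refine Finset.sum_le_sum fun N hN => ?_
  have h2 : edgeSum N (t.lodayPoint ω ℳ) = t.bound ω N := by
    rw [edgeSum_apply, sum_eq_bound hℳ ω (hsub hN)]
  rw [h2]
  -- The coefficient of the set of all edges may be negative, so the equation is needed there.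
  by_cases hNu : N = Finset.univ
  · subst hNu
    rw [hu]
    obtain ⟨e, -⟩ := (hn.nest _ hN).1
    exact Nat.zero_lt_of_lt e.2
  · exact mul_le_mul_of_nonneg_left (h N (hn.nest N hN)) (hc N hN hNu).le

/-- The directions orthogonal to the active constraints stay in the polytope. -/
theorem eventually_mem (hx : x ∈ t.lodayPolytope ω)
    (hd : ∀ N, t.IsNest N → edgeSum N x = t.bound ω N → edgeSum N d = 0) :
    ∀ᶠ ε in nhds (0 : ℝ), x + ε • d ∈ t.lodayPolytope ω := by
  have : ∀ N, ∀ᶠ ε in nhds (0 : ℝ), t.IsNest N → t.bound ω N ≤ edgeSum N (x + ε • d) := by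
    intro N
    -- Tight constraints do not change along `d`, and slack ones survive for small `ε`.
    rcases (bound_le_edgeSum hx N).eq_or_lt with heq | hlt
    · refine Filter.Eventually.of_forall fun ε hN => ?_
      rw [map_add, map_smul, hd N hN heq.symm, smul_zero, add_zero, heq]
    · have hcont : Continuous fun ε : ℝ => edgeSum N (x + ε • d) := by fun_prop
      have := hcont.tendsto 0
      simp only [zero_smul, add_zero] at this
      filter_upwards [this.eventually_const_lt hlt] with ε hε _ using hε.le
  filter_upwards [Filter.eventually_all.2 this] with ε hε
  refine mem_lodayPolytope hε fun hm => ?_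
  have hu := edgeSum_univ hx hm
  rw [map_add, map_smul, hd _ (t.isNest_univ hm) hu, smul_zero, add_zero, hu]

end Polyhedron

/-! ## Faces -/

section Faces

variable {𝒩 𝒩' : Finset (Finset (Fin m))} {N : Finset (Fin m)} {ω : Fin (m + 1) → ℕ+} {x y d : E m}

/-- The face of the Loday polytope for a nesting. -/
def face (t : PT (m + 1)) (ω : Fin (m + 1) → ℕ+) (𝒩 : Finset (Finset (Fin m))) : Set (E m) :=
  {x ∈ t.lodayPolytope ω | ∀ N ∈ 𝒩, edgeSum N x = t.bound ω N}

theorem lodayPoint_mem_face (h : t.IsNesting 𝒩) (h' : 𝒩' ∈ t.maximalNestings) :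
    t.lodayPoint ω 𝒩' ∈ t.face ω 𝒩 ↔ 𝒩 ⊆ 𝒩' := by
  constructor
  · intro hmem N hN
    refine (sum_eq_bound_iff h' ω (h.nest N hN)).1 ?_
    rw [← edgeSum_apply]
    exact hmem.2 N hN
  · refine fun hsub => ⟨lodayPoint_mem h' ω, fun N hN => ?_⟩
    rw [edgeSum_apply, sum_eq_bound h' ω (hsub hN)]

theorem face_nonempty (h : t.IsNesting 𝒩) (ω : Fin (m + 1) → ℕ+) : (t.face ω 𝒩).Nonempty := by
  obtain ⟨ℳ, hℳ, hsub⟩ := h.exists_maximal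
  exact ⟨_, (lodayPoint_mem_face h hℳ).2 hsub⟩

/-- A nest of `𝒩'` missing from `𝒩` is avoided by some maximal nesting containing `𝒩`, whose vertex
lies in the first face and not in the second. -/
theorem face_subset_face (h : t.IsNesting 𝒩) (h' : t.IsNesting 𝒩') :
    t.face ω 𝒩 ⊆ t.face ω 𝒩' ↔ 𝒩' ⊆ 𝒩 := by
  constructor
  · intro hsub N hN
    by_contra hN'
    obtain ⟨ℳ, hℳ, hs, hNℳ⟩ := h.exists_maximal_notMem (h'.nest N hN) hN'
    exact hNℳ ((lodayPoint_mem_face h' hℳ).1 (hsub ((lodayPoint_mem_face h hℳ).2 hs)) hN)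
  · exact fun hsub x hx => ⟨hx.1, fun N hN => hx.2 N (hsub hN)⟩

/-- The inequality holds term by term, so equality of the sums forces equality of the terms. The
term of `univ` is constant, hence its coefficient may have any sign. -/
theorem sum_mul_bound_le {c : Finset (Fin m) → ℝ} (h : t.IsNesting 𝒩)
    (hc : ∀ N ∈ 𝒩, N ≠ Finset.univ → 0 < c N) (hx : x ∈ t.lodayPolytope ω) :
    ∑ N ∈ 𝒩, c N * t.bound ω N ≤ ∑ N ∈ 𝒩, c N * edgeSum N x ∧
    (∑ N ∈ 𝒩, c N * edgeSum N x = ∑ N ∈ 𝒩, c N * t.bound ω N ↔ x ∈ t.face ω 𝒩) := by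
  have hterm : ∀ N ∈ 𝒩, c N * t.bound ω N ≤ c N * edgeSum N x ∧
      (c N * t.bound ω N = c N * edgeSum N x → edgeSum N x = t.bound ω N) := by
    intro N hN
    by_cases hu : N = Finset.univ
    · subst hu
      obtain ⟨e, -⟩ := (h.nest _ hN).1
      rw [edgeSum_univ hx (Nat.zero_lt_of_lt e.2)]
      exact ⟨le_rfl, fun _ => rfl⟩
    · exact ⟨mul_le_mul_of_nonneg_left (bound_le_edgeSum hx N) (hc N hN hu).le,
        fun heq => (mul_left_cancel₀ (hc N hN hu).ne' heq).symm⟩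
  refine ⟨Finset.sum_le_sum fun N hN => (hterm N hN).1, fun heq => ⟨hx, fun N hN => ?_⟩,
    fun hf => Finset.sum_congr rfl fun N hN => by rw [hf.2 N hN]⟩
  exact (hterm N hN).2
    ((Finset.sum_eq_sum_iff_of_le fun N hN => (hterm N hN).1).1 heq.symm N hN)

/-- Exposed sets are sets of maximisers, whereas nests give lower bounds; the form is negated. -/
theorem isExposed_of_forall_iff {s B : Set (E m)} {l : E m →L[ℝ] ℝ} {a : ℝ}
    (hl : ∀ x ∈ s, a ≤ l x) (hB : ∀ x, x ∈ B ↔ x ∈ s ∧ l x = a) : IsExposed ℝ s B := by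
  rintro ⟨z, hz⟩
  refine ⟨-l, Set.ext fun x => (hB x).trans ⟨fun h => ⟨h.1, fun y hy => ?_⟩,
    fun h => ⟨h.1, le_antisymm ?_ (hl x h.1)⟩⟩⟩
  · simpa [h.2] using hl y hy
  · have := h.2 z ((hB z).1 hz).1
    simpa [((hB z).1 hz).2] using this

theorem isExposed_face (h : t.IsNesting 𝒩) (ω : Fin (m + 1) → ℕ+) :
    IsExposed ℝ (t.lodayPolytope ω) (t.face ω 𝒩) := by
  have hs : ∀ x ∈ t.lodayPolytope ω, _ := fun x hx =>
    sum_mul_bound_le (c := fun _ => 1) h (fun _ _ _ => one_pos) hx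
  refine isExposed_of_forall_iff (l := ∑ N ∈ 𝒩, edgeSum N) (a := ∑ N ∈ 𝒩, t.bound ω N)
    (fun x hx => ?_) fun x => ⟨fun hx => ⟨hx.1, ?_⟩, fun hx => ?_⟩
  · simpa using (hs x hx).1
  · simpa using (hs x hx.1).2.2 hx
  · exact (hs x hx.1).2.1 (by simpa using hx.2)

/-- `B` consists of the minimisers of `-l`, and the expansion of `-l` over a nesting is least
exactly on the face of that nesting. -/
theorem exists_face_eq {B : Set (E m)} (hB : IsExposed ℝ (t.lodayPolytope ω) B)
    (hne : B.Nonempty) : ∃ 𝒩, t.IsNesting 𝒩 ∧ B = t.face ω 𝒩 := by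
  obtain ⟨l, hl⟩ := hB hne
  obtain ⟨𝒩, hn, c, hc, hlc⟩ := exists_nesting_linear_eq t (-l)
  obtain ⟨z, hz⟩ := face_nonempty hn ω
  have hs : ∀ x ∈ t.lodayPolytope ω, _ := fun x hx => sum_mul_bound_le hn hc hx
  have hval : ∀ x, l x = - ∑ N ∈ 𝒩, c N * edgeSum N x := fun x => by
    rw [← hlc]; simp
  refine ⟨𝒩, hn, Set.ext fun x => ?_⟩
  rw [hl]
  constructor
  · rintro ⟨hx, hmax⟩
    refine (hs x hx).2.1 (le_antisymm ?_ (hs x hx).1)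
    have := hmax z hz.1
    rw [hval, hval, (hs z hz.1).2.2 hz] at this
    linarith
  · intro hx
    refine ⟨hx.1, fun y hy => ?_⟩
    rw [hval, hval, (hs x hx.1).2.2 hx]
    linarith [(hs y hy).1]

end Faces

/-! ## Sums over the blocks of a nesting -/

section Blocks

variable {𝒩 : Finset (Finset (Fin m))} {N : Finset (Fin m)} {ω : Fin (m + 1) → ℕ+} {d : Fin m → ℝ}

open Classical in
theorem IsNesting.sum_eq_sum_blocks (h : t.IsNesting 𝒩) (hN : N ∈ 𝒩) (d : Fin m → ℝ) :
    ∑ i ∈ N, d i = ∑ L ∈ 𝒩.filter (· ⊆ N), ∑ i ∈ Finset.univ.filter (minNest 𝒩 · = L), d i := by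
  rw [← Finset.sum_fiberwise_of_maps_to (t := 𝒩.filter (· ⊆ N)) (g := minNest 𝒩)]
  · refine Finset.sum_congr rfl fun L hL => Finset.sum_congr ?_ fun _ _ => rfl
    ext i
    simp only [Finset.mem_filter, Finset.mem_univ, true_and, and_iff_right_iff_imp]
    rintro rfl
    exact (Finset.mem_filter.1 hL).2 (h.mem_minNest i)
  · exact fun i hi => Finset.mem_filter.2 ⟨h.minNest_mem i, h.minNest_subset hN hi⟩

open Classical in
-- The sum over `L` splits into the blocks of the nests inside `L`, and by induction only the block
-- of `L` itself remains. Conditions on nests thus become conditions on the blocks of a partition.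
theorem IsNesting.sum_blocks_eq_zero (h : t.IsNesting 𝒩) (hd : ∀ N ∈ 𝒩, ∑ i ∈ N, d i = 0)
    (L : Finset (Fin m)) : ∑ i ∈ Finset.univ.filter (minNest 𝒩 · = L), d i = 0 := by
  by_cases hL : L ∈ 𝒩
  · induction L using Finset.strongInduction with
    | H L ih =>
      have h1 := h.sum_eq_sum_blocks hL d
      rw [hd L hL, ← Finset.add_sum_erase _ _
        (show L ∈ 𝒩.filter (· ⊆ L) from Finset.mem_filter.2 ⟨hL, subset_rfl⟩),
        Finset.sum_eq_zero (s := (𝒩.filter (· ⊆ L)).erase L)] at h1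
      · rw [add_zero] at h1
        exact h1.symm
      · intro L' hL'
        simp only [Finset.mem_erase, Finset.mem_filter] at hL'
        exact ih L' (Finset.ssubset_iff_subset_ne.2 ⟨hL'.2.2, hL'.1⟩) hL'.2.1
  · rw [Finset.filter_false_of_mem, Finset.sum_empty]
    rintro i - rfl
    exact hL (h.minNest_mem i)

end Blocks

end Operahedra.PT

namespace Operahedra

/-! ## Alternating cycles -/

section Alternating

variable {ι A B : Type*} {d : ι → ℝ}

theorem exists_neg_of_pos (s : Finset ι) (h : ∑ i ∈ s, d i = 0) {i : ι} (hi : i ∈ s)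
    (hd : 0 < d i) : ∃ j ∈ s, d j < 0 := by
  by_contra! hcon
  have := (Finset.sum_eq_zero_iff_of_nonneg hcon).1 h i hi
  exact hd.ne' this

open Classical in
/-- A nonzero vector whose sums over the blocks of two partitions vanish gives an alternating
cycle: two disjoint sets of the same cardinality in each block of both partitions. -/
theorem exists_alternating [Fintype ι] [DecidableEq A] [DecidableEq B] (p : ι → A) (q : ι → B) (hd : d ≠ 0)
    (hp : ∀ a, ∑ i ∈ Finset.univ.filter (p · = a), d i = 0)
    (hq : ∀ b, ∑ i ∈ Finset.univ.filter (q · = b), d i = 0) :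
    ∃ I J : Finset ι, I.Nonempty ∧ Disjoint I J ∧
      (∀ (P : ι → Prop) [DecidablePred P], (∀ i j, p i = p j → (P i ↔ P j)) →
        (I.filter P).card = (J.filter P).card) ∧
      ∀ (P : ι → Prop) [DecidablePred P], (∀ i j, q i = q j → (P i ↔ P j)) →
        (I.filter P).card = (J.filter P).card := by
  have hσ : ∀ i, ∃ j, 0 < d i → d j < 0 ∧ p j = p i := by
    intro i
    by_cases hi : 0 < d i
    · obtain ⟨j, hj, hneg⟩ := exists_neg_of_pos _ (hp (p i)) (i := i) (by simp) hi
      exact ⟨j, fun _ => ⟨hneg, (Finset.mem_filter.1 hj).2⟩⟩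
    · exact ⟨i, fun h => absurd h hi⟩
  have hτ : ∀ i, ∃ j, d i < 0 → 0 < d j ∧ q j = q i := by
    intro i
    by_cases hi : d i < 0
    · obtain ⟨j, hj, hneg⟩ := exists_neg_of_pos (d := fun i => -d i) _
        (by simpa using hq (q i)) (i := i) (by simp) (neg_pos.2 hi)
      exact ⟨j, fun _ => ⟨neg_neg_iff_pos.1 hneg, (Finset.mem_filter.1 hj).2⟩⟩
    · exact ⟨i, fun h => absurd h hi⟩
  choose σ hσ using hσ
  choose τ hτ using hτ
  obtain ⟨i₀, hi₀⟩ : ∃ i, 0 < d i := by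
    obtain ⟨i, hi⟩ := Function.ne_iff.1 hd
    rcases lt_or_gt_of_ne hi with h | h
    · exact ⟨τ i, (hτ i h).1⟩
    · exact ⟨i, h⟩
  -- `σ` goes from a positive to a negative entry in the same `p`-block, and `τ` goes back within a
  -- `q`-block. On the finite set of positive entries, `f = τ ∘ σ` permutes its periodic points;
  -- these form `I`, and their images under `σ` form `J`.
  let f : {i // 0 < d i} → {i // 0 < d i} := fun i => ⟨τ (σ i), (hτ _ (hσ i i.2).1).1⟩
  let T : Finset {i // 0 < d i} := Finset.univ.filter (· ∈ Function.periodicPts f)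
  have hbij : Set.BijOn f (Function.periodicPts f) (Function.periodicPts f) :=
    Function.bijOn_periodicPts f
  have hT : ∀ i, i ∈ T ↔ i ∈ Function.periodicPts f := fun i => by simp [T]
  let I : Finset ι := T.image Subtype.val
  let J : Finset ι := I.image σ
  have hIpos : ∀ i ∈ I, 0 < d i := fun i hi => by
    obtain ⟨a, -, rfl⟩ := Finset.mem_image.1 hi
    exact a.2
  have hJneg : ∀ j ∈ J, d j < 0 := fun j hj => by
    obtain ⟨i, hi, rfl⟩ := Finset.mem_image.1 hj
    exact (hσ i (hIpos i hi)).1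
  have hIJ : ∀ j ∈ J, τ j ∈ I := fun j hj => by
    obtain ⟨i, hi, rfl⟩ := Finset.mem_image.1 hj
    obtain ⟨a, ha, rfl⟩ := Finset.mem_image.1 hi
    exact Finset.mem_image.2 ⟨f a, (hT _).2 (hbij.mapsTo ((hT a).1 ha)), rfl⟩
  have hτσ : Set.InjOn (fun i => τ (σ i)) I := by
    intro i hi j hj hij
    obtain ⟨a, ha, rfl⟩ := Finset.mem_image.1 hi
    obtain ⟨b, hb, rfl⟩ := Finset.mem_image.1 hj
    exact congrArg Subtype.val (hbij.injOn ((hT a).1 ha) ((hT b).1 hb) (Subtype.ext hij))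
  have hσinj : Set.InjOn σ I := fun i hi j hj hij => hτσ hi hj (congrArg τ hij)
  have hτinj : Set.InjOn τ J := by
    intro i hi j hj hij
    obtain ⟨a, ha, rfl⟩ := Finset.mem_image.1 hi
    obtain ⟨b, hb, rfl⟩ := Finset.mem_image.1 hj
    exact congrArg σ (hτσ ha hb hij)
  have hτsurj : ∀ i ∈ I, ∃ j ∈ J, τ j = i := by
    intro i hi
    obtain ⟨a, ha, rfl⟩ := Finset.mem_image.1 hi
    obtain ⟨b, hb, rfl⟩ := hbij.surjOn ((hT a).1 ha)
    exact ⟨σ b, Finset.mem_image_of_mem _ (Finset.mem_image_of_mem _ ((hT b).2 hb)), rfl⟩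
  refine ⟨I, J, ?_, ?_, fun P _ hP => ?_, fun P _ hP => ?_⟩
  · obtain ⟨a, ha⟩ : (Function.periodicPts f).Nonempty := by
      -- The orbit of `i₀` in a finite set repeats a value, which is then periodic.
      obtain ⟨a, b, hab, h⟩ := Finite.exists_ne_map_eq_of_infinite fun n => f^[n] ⟨i₀, hi₀⟩
      wlog hlt : a < b generalizing a b
      · exact this b a hab.symm h.symm (lt_of_le_of_ne (not_lt.1 hlt) hab.symm)
      refine ⟨f^[a] ⟨i₀, hi₀⟩, Function.mk_mem_periodicPts (Nat.sub_pos_of_lt hlt) ?_⟩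
      rw [Function.IsPeriodicPt, Function.IsFixedPt, ← Function.iterate_add_apply,
        Nat.sub_add_cancel hlt.le]
      exact h.symm
    exact ⟨a, Finset.mem_image_of_mem _ ((hT a).2 ha)⟩
  · exact Finset.disjoint_left.2 fun i hi hj => lt_asymm (hIpos i hi) (hJneg i hj)
  -- `σ` is a bijection from `I` to `J` that preserves `p`-blocks; `τ` plays this part from `J` to
  -- `I` for `q`-blocks.
  · refine Finset.card_bij (fun i _ => σ i) (fun i hi => ?_) (fun i hi j hj hij => ?_)
      fun j hj => ?_
    · obtain ⟨hi, hPi⟩ := Finset.mem_filter.1 hi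
      exact Finset.mem_filter.2 ⟨Finset.mem_image_of_mem _ hi,
        (hP _ _ (hσ i (hIpos i hi)).2).2 hPi⟩
    · exact hσinj (Finset.mem_filter.1 hi).1 (Finset.mem_filter.1 hj).1 hij
    · obtain ⟨hj, hPj⟩ := Finset.mem_filter.1 hj
      obtain ⟨i, hi, rfl⟩ := Finset.mem_image.1 hj
      exact ⟨i, Finset.mem_filter.2 ⟨hi, (hP _ _ (hσ i (hIpos i hi)).2).1 hPj⟩, rfl⟩
  · refine (Finset.card_bij (fun i _ => τ i) (fun i hi => ?_) (fun i hi j hj hij => ?_)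
      fun j hj => ?_).symm
    · obtain ⟨hi, hPi⟩ := Finset.mem_filter.1 hi
      exact Finset.mem_filter.2 ⟨hIJ i hi, (hP _ _ (hτ i (hJneg i hi)).2).2 hPi⟩
    · exact hτinj (Finset.mem_filter.1 hi).1 (Finset.mem_filter.1 hj).1 hij
    · obtain ⟨hj, hPj⟩ := Finset.mem_filter.1 hj
      obtain ⟨i, hi, rfl⟩ := hτsurj j hj
      exact ⟨i, Finset.mem_filter.2 ⟨hi, (hP _ _ (hτ i (hJneg i hi)).2).1 hPj⟩, rfl⟩

end Alternating

/-- The genericity condition of the bot-top diagonal, without the condition on the minimum. -/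
theorem sum_ne_sum_of_generic {m : ℕ} {v : E m}
    (hv : ∀ p ∈ D m, ∑ i ∈ p.1, v i ≠ ∑ j ∈ p.2, v j) {I J : Finset (Fin m)}
    (hI : I.Nonempty) (hc : I.card = J.card) (hd : Disjoint I J) :
    ∑ i ∈ I, v i ≠ ∑ j ∈ J, v j := by
  obtain ⟨k, hk, hmin⟩ := (I ∪ J).exists_min_image id (hI.mono Finset.subset_union_left)
  rcases Finset.mem_union.1 hk with h | h
  · exact hv (I, J) ⟨hc, hd, k, h, hmin⟩
  · exact (hv (J, I) ⟨hc.symm, hd.symm, k, h, by rwa [Finset.union_comm]⟩).symm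

namespace PT

variable {m : ℕ} {t : PT (m + 1)} {ω : Fin (m + 1) → ℕ+} {v x y z : E m}

/-! ## Reflections of Loday polytopes -/

theorem mem_reflect {P : Set (E m)} : x ∈ reflect z P ↔ (2 : ℝ) • z - x ∈ P := by
  constructor
  · rintro ⟨y, hy, rfl⟩
    simpa using hy
  · exact fun h => ⟨_, h, by simp⟩

/-- The nests tight at `x` lie in a common maximal nesting, so they inherit its compatibility; the
set of all edges is always tight. -/
theorem exists_active_nesting (hx : x ∈ t.lodayPolytope ω) :
    ∃ 𝒩, t.IsNesting 𝒩 ∧ ∀ N, N ∈ 𝒩 ↔ t.IsNest N ∧ edgeSum N x = t.bound ω N := by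
  classical
  obtain ⟨ℳ, hℳ, hsub⟩ := exists_maximal_of_mem hx
  refine ⟨Finset.univ.filter fun N => t.IsNest N ∧ edgeSum N x = t.bound ω N,
    (mem_maximalNestings.1 hℳ).1.of_subset (fun N hN => ?_) fun hm => ?_, fun N => by simp⟩
  · exact hsub N (Finset.mem_filter.1 hN).2.1 (Finset.mem_filter.1 hN).2.2
  · exact Finset.mem_filter.2 ⟨Finset.mem_univ _, t.isNest_univ hm, edgeSum_univ hx hm⟩

/-- Both sums are at least the bound and their mean equals it. -/
theorem edgeSum_sub_eq_zero {N : Finset (Fin m)} (hx : x ∈ t.lodayPolytope ω)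
    (hy : y ∈ t.lodayPolytope ω) (h : edgeSum N (midpoint ℝ x y) = t.bound ω N) :
    edgeSum N (y - x) = 0 := by
  have h1 := bound_le_edgeSum hx N
  have h2 := bound_le_edgeSum hy N
  rw [midpoint_eq_smul_add, map_smul, map_add, smul_eq_mul] at h
  norm_num at h
  rw [map_sub]
  linarith

/-- Between two distinct points of `P ∩ ρ_z P` there is a segment in `P ∩ ρ_z P` with the same
midpoint that is not perpendicular to `v`. -/
theorem exists_direction (hv : ∀ p ∈ D m, ∑ i ∈ p.1, v i ≠ ∑ j ∈ p.2, v j)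
    (hx : x ∈ t.lodayPolytope ω ∩ reflect z (t.lodayPolytope ω))
    (hy : y ∈ t.lodayPolytope ω ∩ reflect z (t.lodayPolytope ω)) (hxy : x ≠ y) :
    ∃ (c : E m) (ε : ℝ), inner ℝ c v ≠ 0 ∧ 0 < ε ∧
      midpoint ℝ x y + ε • c ∈ t.lodayPolytope ω ∩ reflect z (t.lodayPolytope ω) ∧
      midpoint ℝ x y + (-ε) • c ∈ t.lodayPolytope ω ∩ reflect z (t.lodayPolytope ω) := by
  classical
  have hP := t.convex_lodayPolytope ω
  have hx' := mem_reflect.1 hx.2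
  have hy' := mem_reflect.1 hy.2
  have hmid' : midpoint ℝ ((2 : ℝ) • z - x) ((2 : ℝ) • z - y) = (2 : ℝ) • z - midpoint ℝ x y := by
    simp only [midpoint_eq_smul_add, invOf_eq_inv]
    module
  obtain ⟨𝒩, hn, hN⟩ := exists_active_nesting (hP.midpoint_mem hx.1 hy.1)
  obtain ⟨𝒩', hn', hN'⟩ := exists_active_nesting (hP.midpoint_mem hx' hy')
  have hne : (fun i => (y - x) i) ≠ 0 := fun h => hxy (sub_eq_zero.1 (by
    ext i; exact congrFun h i)).symm
  obtain ⟨I, J, hI, hd, hp, hq⟩ := exists_alternating (minNest 𝒩) (minNest 𝒩') hne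
    (hn.sum_blocks_eq_zero fun N h => by
      rw [← edgeSum_apply]; exact edgeSum_sub_eq_zero hx.1 hy.1 ((hN N).1 h).2)
    (hn'.sum_blocks_eq_zero fun N h => by
      have := edgeSum_sub_eq_zero hx' hy' ((hN' N).1 h).2
      rw [sub_sub_sub_cancel_left, ← neg_sub, map_neg, neg_eq_zero] at this
      rw [← edgeSum_apply]; exact this)
  -- The difference of the indicators of `I` and `J`. Its sum over a tight nest is zero, because the
  -- nest is a union of blocks.
  let c : E m := WithLp.toLp 2 fun i => (if i ∈ I then 1 else 0) - if i ∈ J then 1 else 0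
  have hsum : ∀ N, edgeSum N c = ((I.filter (· ∈ N)).card : ℝ) - ((J.filter (· ∈ N)).card : ℝ) := by
    intro N
    rw [edgeSum_apply]
    simp only [c, Finset.sum_sub_distrib, Finset.sum_ite_mem, Finset.sum_const, nsmul_eq_mul,
      mul_one, Finset.filter_mem_eq_inter, Finset.inter_comm]
  have hinv : ∀ {𝒩}, t.IsNesting 𝒩 → ∀ N ∈ 𝒩, ∀ i j, minNest 𝒩 i = minNest 𝒩 j →
      (i ∈ N ↔ j ∈ N) := fun h N hN i j hij => by
    rw [h.mem_iff_minNest_subset hN, h.mem_iff_minNest_subset hN, hij]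
  have hcard : I.card = J.card := by simpa using hp (fun _ => True) fun _ _ _ => Iff.rfl
  have h1 := eventually_mem (d := c) (hP.midpoint_mem hx.1 hy.1) fun N hN1 hN2 => by
    have h := (hN N).2 ⟨hN1, hN2⟩
    rw [hsum, hp (· ∈ N) (hinv hn N h), sub_self]
  have h2 := eventually_mem (d := -c) (hP.midpoint_mem hx' hy') fun N hN1 hN2 => by
    have h := (hN' N).2 ⟨hN1, hN2⟩
    rw [map_neg, hsum, hq (· ∈ N) (hinv hn' N h), sub_self, neg_zero]
  have hev : ∀ᶠ ε in nhds (0 : ℝ),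
      midpoint ℝ x y + ε • c ∈ t.lodayPolytope ω ∩ reflect z (t.lodayPolytope ω) := by
    filter_upwards [h1, h2] with ε h1 h2
    refine ⟨h1, mem_reflect.2 ?_⟩
    rw [hmid'] at h2
    convert h2 using 1
    rw [smul_neg]
    abel
  have hneg : Filter.Tendsto (fun ε : ℝ => -ε) (nhds 0) (nhds 0) := by
    simpa using (continuous_neg (G := ℝ)).tendsto 0
  obtain ⟨ε, ⟨hε1, hε2⟩, hε⟩ := (((hev.and (hneg.eventually hev)).filter_mono
    nhdsWithin_le_nhds).and (self_mem_nhdsWithin (s := Set.Ioi (0 : ℝ)))).exists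
  refine ⟨c, ε, ?_, hε, hε1, hε2⟩
  have : inner ℝ c v = ∑ i ∈ I, v i - ∑ j ∈ J, v j := by
    simp [PiLp.inner_apply, c, mul_sub, Finset.sum_sub_distrib]
  rw [this]
  exact sub_ne_zero.2 (sum_ne_sum_of_generic hv hI hcard hd)

/-- A segment in `P ∩ ρ_z P` centred at the midpoint of an edge lies in that edge. So the direction
`c`, not perpendicular to `v`, is parallel to `y - x`. -/
theorem positivelyOriented_lodayPolytope (hv : ∀ p ∈ D m, ∑ i ∈ p.1, v i ≠ ∑ j ∈ p.2, v j) :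
    PositivelyOriented (t.lodayPolytope ω) v := by
  intro z _ x y ⟨hne, hexp⟩
  have hx := hexp.subset (left_mem_segment ℝ x y)
  have hy := hexp.subset (right_mem_segment ℝ x y)
  obtain ⟨c, ε, hc, hε, h1, h2⟩ := exists_direction hv hx hy hne
  have hmem : midpoint ℝ x y ∈ openSegment ℝ (midpoint ℝ x y + ε • c) (midpoint ℝ x y + (-ε) • c) :=
    ⟨1 / 2, 1 / 2, by norm_num, by norm_num, by norm_num, by module⟩
  have hseg := hexp.isExtreme.left_mem_of_mem_openSegment h1 h2 (midpoint_mem_segment x y) hmem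
  obtain ⟨θ, -, hθ⟩ := (segment_eq_image' ℝ x y ▸ hseg)
  intro h0
  have : ε * inner ℝ c v = (θ - 1 / 2) * inner ℝ (y - x) v := by
    rw [← real_inner_smul_left, ← real_inner_smul_left]
    congr 1
    rw [midpoint_eq_smul_add] at hθ
    change x + θ • (y - x) = _ at hθ
    have : ε • c = x + θ • (y - x) - (⅟2 : ℝ) • (x + y) := by rw [hθ]; abel
    rw [this, invOf_eq_inv]
    module
  rw [h0, mul_zero] at this
  exact hc ((mul_eq_zero.1 this).resolve_left hε.ne')

/-- A minimum of `⟨-, v⟩` on `P ∩ ρ_z P` is unique. -/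
theorem eq_of_inner_minimal (hv : ∀ p ∈ D m, ∑ i ∈ p.1, v i ≠ ∑ j ∈ p.2, v j)
    (hx : x ∈ t.lodayPolytope ω ∩ reflect z (t.lodayPolytope ω))
    (hy : y ∈ t.lodayPolytope ω ∩ reflect z (t.lodayPolytope ω))
    (hmin : ∀ u ∈ t.lodayPolytope ω ∩ reflect z (t.lodayPolytope ω), inner ℝ x v ≤ inner ℝ u v)
    (hyx : inner ℝ y v ≤ inner ℝ x v) : x = y := by
  by_contra hne
  obtain ⟨c, ε, hc, hε, h1, h2⟩ := exists_direction hv hx hy hne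
  have h1 := hmin _ h1
  have h2 := hmin _ h2
  -- The midpoint is a minimum too, so the form decreases neither along `c` nor along `-c`, which
  -- forces `inner ℝ c v = 0`.
  have hm : inner ℝ (midpoint ℝ x y) v ≤ inner ℝ x v := by
    rw [midpoint_eq_smul_add, real_inner_smul_left, inner_add_left, invOf_eq_inv]
    linarith
  rw [inner_add_left, real_inner_smul_left] at h1 h2
  have h3 : ε * inner ℝ c v = 0 := by linarith
  exact hc ((mul_eq_zero.1 h3).resolve_left hε.ne')

-- Existence of the bot-top diagonal and tightness.

theorem exists_isBot (hv : ∀ p ∈ D m, ∑ i ∈ p.1, v i ≠ ∑ j ∈ p.2, v j)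
    (hz : z ∈ t.lodayPolytope ω) :
    ∃ x, IsBot (t.lodayPolytope ω ∩ reflect z (t.lodayPolytope ω)) v x := by
  have hcomp : IsCompact (t.lodayPolytope ω ∩ reflect z (t.lodayPolytope ω)) :=
    (t.isCompact_lodayPolytope ω).inter
      ((t.isCompact_lodayPolytope ω).image (by fun_prop))
  have hne : (t.lodayPolytope ω ∩ reflect z (t.lodayPolytope ω)).Nonempty :=
    ⟨z, hz, mem_reflect.2 (by rwa [two_smul, add_sub_cancel_right])⟩
  obtain ⟨x, hx, hmin⟩ := hcomp.exists_isMinOn hne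
    (f := fun x => inner ℝ x v) (by fun_prop)
  refine ⟨x, hx, fun y hy hyx => ?_⟩
  by_contra! hle
  exact hyx (eq_of_inner_minimal hv hx hy hmin hle).symm

theorem reflect_mem (hx : x ∈ t.lodayPolytope ω ∩ reflect z (t.lodayPolytope ω)) :
    (2 : ℝ) • z - x ∈ t.lodayPolytope ω ∩ reflect z (t.lodayPolytope ω) :=
  ⟨mem_reflect.1 hx.2, mem_reflect.2 (by simpa using hx.1)⟩

/-- `P ∩ ρ_z P` is symmetric about `z`, and the reflection exchanges minima and maxima. -/
theorem isTop_of_isBot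
    (h : IsBot (t.lodayPolytope ω ∩ reflect z (t.lodayPolytope ω)) v x) :
    IsTop (t.lodayPolytope ω ∩ reflect z (t.lodayPolytope ω)) v ((2 : ℝ) • z - x) := by
  refine ⟨reflect_mem h.1, fun y hy hne => ?_⟩
  have := h.2 _ (reflect_mem hy) fun heq => hne (by rw [← heq]; simp)
  rw [inner_sub_left] at this ⊢
  linarith

/-- The map `x ↦ (x, 2z - x)` identifies `P ∩ ρ_z P` with the fibre of `π` over `z`, and there `φ =
2⟨x - z, v⟩`. So the minimiser of `φ` comes from the bottom, and its second entry is the top. -/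
theorem exists_isBotTopDiagonal (hv : ∀ p ∈ D m, ∑ i ∈ p.1, v i ≠ ∑ j ∈ p.2, v j) :
    ∃ Δ, IsBotTopDiagonal (t.lodayPolytope ω) v Δ := by
  have hex : ∀ z : t.lodayPolytope ω,
      ∃ x, IsBot (t.lodayPolytope ω ∩ reflect z.1 (t.lodayPolytope ω)) v x :=
    fun z => exists_isBot hv z.2
  choose b hb using hex
  refine ⟨fun z => (⟨b z, (hb z).1.1⟩, ⟨(2 : ℝ) • z.1 - b z, mem_reflect.1 (hb z).1.2⟩),
    fun z => ⟨?_, fun q hq hne => ?_, hb z, isTop_of_isBot (hb z)⟩⟩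
  · simp only [proj]
    module
  · obtain ⟨⟨x, hx⟩, ⟨y, hy⟩⟩ := q
    have hxy : y = (2 : ℝ) • z.1 - x := by
      rw [← hq]
      simp only [proj]
      module
    subst hxy
    have := (hb z).2 x ⟨hx, mem_reflect.2 hy⟩ fun h => hne (by simp [h])
    simp only [height, inner_sub_left]
    linarith

/-- The vectors in the direction of a convex set are multiples of differences. -/
theorem exists_smul_sub_of_mem_vectorSpan {V : Type*} [AddCommGroup V] [Module ℝ V] {s : Set V}
    (hs : Convex ℝ s) (hne : s.Nonempty) {d : V} (hd : d ∈ vectorSpan ℝ s) :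
    ∃ a ∈ s, ∃ b ∈ s, ∃ r : ℝ, 0 ≤ r ∧ d = r • (a - b) := by
  obtain ⟨s₀, hs₀⟩ := hne
  rw [vectorSpan] at hd
  induction hd using Submodule.span_induction with
  | mem d hd =>
    obtain ⟨a, ha, b, hb, rfl⟩ := hd
    exact ⟨a, ha, b, hb, 1, zero_le_one, by simp⟩
  | zero => exact ⟨s₀, hs₀, s₀, hs₀, 0, le_rfl, by simp⟩
  | smul r d _ ih =>
    obtain ⟨a, ha, b, hb, k, hk, rfl⟩ := ih
    rcases le_total 0 r with hr | hr
    · exact ⟨a, ha, b, hb, r * k, mul_nonneg hr hk, by module⟩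
    · exact ⟨b, hb, a, ha, -r * k, mul_nonneg (neg_nonneg.2 hr) hk, by module⟩
  | add d d' _ _ ih ih' =>
    obtain ⟨a, ha, b, hb, k, hk, rfl⟩ := ih
    obtain ⟨a', ha', b', hb', k', hk', rfl⟩ := ih'
    rcases eq_or_lt_of_le (add_nonneg hk hk') with h | h
    · have h1 : k = 0 := by linarith
      have h2 : k' = 0 := by linarith
      exact ⟨a, ha, b, hb, 0, le_rfl, by simp [h1, h2]⟩
    · have h1 : k / (k + k') + k' / (k + k') = 1 := by field_simp
      refine ⟨_, hs ha ha' (div_nonneg hk h.le) (div_nonneg hk' h.le) h1,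
        _, hs hb hb' (div_nonneg hk h.le) (div_nonneg hk' h.le) h1, k + k', h.le, ?_⟩
      have h2 : (k + k') * (k / (k + k')) = k := mul_div_cancel₀ _ h.ne'
      have h3 : (k + k') * (k' / (k + k')) = k' := mul_div_cancel₀ _ h.ne'
      simp only [smul_sub, smul_add, smul_smul, h2, h3]
      abel

/-- The projection `π` as a linear map. -/
noncomputable def projLinear (m : ℕ) : E m × E m →ₗ[ℝ] E m :=
  (1 / 2 : ℝ) • (LinearMap.fst ℝ (E m) (E m) + LinearMap.snd ℝ (E m) (E m))

/-- The map `(π, φ)` as a linear map. -/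
noncomputable def liftLinear (v : E m) : E m × E m →ₗ[ℝ] E m × ℝ :=
  (projLinear m).prod (((innerₗ (E m)).flip v) ∘ₗ
    (LinearMap.fst ℝ (E m) (E m) - LinearMap.snd ℝ (E m) (E m)))

/-- Each point in the preimage of a lower face minimises `φ` in its fibre of `π`. Minimisers are
unique, so `π` is injective on the preimage and, by convexity, on its direction space. -/
theorem inducesTightSubdivision (hv : ∀ p ∈ D m, ∑ i ∈ p.1, v i ≠ ∑ j ∈ p.2, v j) :
    InducesTightSubdivision (t.lodayPolytope ω) v := by
  rintro S ⟨L, ⟨hexp, hlow⟩, rfl⟩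
  have hPP := (t.convex_lodayPolytope ω).prod (t.convex_lodayPolytope ω)
  have hlift : Convex ℝ (lifted (t.lodayPolytope ω) v) := hPP.linear_image (liftLinear v)
  have hS : Convex ℝ (t.lodayPolytope ω ×ˢ t.lodayPolytope ω ∩ lift v ⁻¹' L) :=
    hPP.inter ((hexp.convex hlift).linear_preimage (liftLinear v))
  rcases Set.eq_empty_or_nonempty (t.lodayPolytope ω ×ˢ t.lodayPolytope ω ∩ lift v ⁻¹' L)
    with h0 | hne
  · rw [h0, Set.image_empty, vectorSpan_empty, vectorSpan_empty, finrank_bot, finrank_bot]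
  have hspan : vectorSpan ℝ (proj '' (t.lodayPolytope ω ×ˢ t.lodayPolytope ω ∩ lift v ⁻¹' L)) =
      (vectorSpan ℝ (t.lodayPolytope ω ×ˢ t.lodayPolytope ω ∩ lift v ⁻¹' L)).map
        (projLinear m) :=
    (projLinear m).toAffineMap.map_vectorSpan.symm
  rw [hspan]
  rw [← LinearMap.range_domRestrict, LinearMap.finrank_range_of_inj]
  refine (injective_iff_map_eq_zero _).2 fun ⟨d, hd⟩ h0 => ?_
  obtain ⟨a, ha, b, hb, r, -, rfl⟩ := exists_smul_sub_of_mem_vectorSpan hS hne hd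
  rw [LinearMap.domRestrict_apply, map_smul, map_sub, smul_eq_zero, sub_eq_zero] at h0
  rcases h0 with rfl | h0
  · simp
  have hmem : ∀ q ∈ t.lodayPolytope ω ×ˢ t.lodayPolytope ω,
      q.1 ∈ t.lodayPolytope ω ∩ reflect (proj q) (t.lodayPolytope ω) ∧
      q.2 = (2 : ℝ) • proj q - q.1 := by
    intro q hq
    have : q.2 = (2 : ℝ) • proj q - q.1 := by
      simp only [proj]
      module
    exact ⟨⟨hq.1, mem_reflect.2 (this ▸ hq.2)⟩, this⟩
  have hmin : ∀ q ∈ t.lodayPolytope ω ×ˢ t.lodayPolytope ω ∩ lift v ⁻¹' L,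
      ∀ u ∈ t.lodayPolytope ω ∩ reflect (proj q) (t.lodayPolytope ω),
        inner ℝ q.1 v ≤ inner ℝ u v := by
    intro q hq u hu
    by_contra! hlt
    have heq := (hmem q hq.1).2
    -- Exchanging `q.1` for `u` within the fibre lowers `φ` by twice the difference.
    refine hlow (lift v q) hq.2 (2 * (inner ℝ q.1 v - inner ℝ u v)) (by linarith)
      ⟨(u, (2 : ℝ) • proj q - u), ⟨hu.1, mem_reflect.1 hu.2⟩, ?_⟩
    refine Prod.ext ?_ ?_
    · simp only [lift, proj]
      module
    · simp only [lift, height]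
      rw [heq]
      simp only [inner_sub_left]
      ring
  have hproj : proj a = proj b := h0
  have hb' := (hmem b hb.1).1
  rw [← hproj] at hb'
  have h1 : a.1 = b.1 := eq_of_inner_minimal hv (hmem a ha.1).1 hb' (hmin a ha)
    (hmin b hb _ (hproj ▸ (hmem a ha.1).1))
  have h2 : a.2 = b.2 := by rw [(hmem a ha.1).2, (hmem b hb.1).2, h1, hproj]
  have : a = b := Prod.ext h1 h2
  simp [this]

theorem definesBotTopDiagonal (hv : ∀ p ∈ D m, ∑ i ∈ p.1, v i ≠ ∑ j ∈ p.2, v j) :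
    DefinesBotTopDiagonal (t.lodayPolytope ω) v := by
  refine ⟨fun z hz => ?_, inducesTightSubdivision hv, exists_isBotTopDiagonal hv⟩
  obtain ⟨x, hx⟩ := exists_isBot hv hz
  exact ⟨⟨x, hx⟩, _, isTop_of_isBot hx⟩

end PT

end Operahedra

namespace Operahedra.PT

variable {m : ℕ} {t : PT (m + 1)}

/-! ## The face lattice -/

section FaceLattice

variable {𝒩 𝒩' : Finset (Finset (Fin m))} {ω : Fin (m + 1) → ℕ+} {x : E m}

/-- For a maximal nesting every block is a single edge, so the equations of its nests determine all
coordinates. -/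
theorem mem_face_of_maximal (h : 𝒩 ∈ t.maximalNestings) :
    x ∈ t.face ω 𝒩 ↔ x = t.lodayPoint ω 𝒩 := by
  classical
  obtain ⟨hn, hc⟩ := mem_maximalNestings.1 h
  have hM := (lodayPoint_mem_face (ω := ω) hn h).2 subset_rfl
  refine ⟨fun hx => ?_, fun hx => hx ▸ hM⟩
  have hd := hn.sum_blocks_eq_zero (d := fun i => (x - t.lodayPoint ω 𝒩) i) fun N hN => by
    rw [← edgeSum_apply, map_sub, hx.2 N hN, hM.2 N hN, sub_self]
  refine sub_eq_zero.1 (PiLp.ext fun i => ?_)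
  have hi := hd (minNest 𝒩 i)
  rwa [show Finset.univ.filter (minNest 𝒩 · = minNest 𝒩 i) = {i} by
    ext j; simp [(hn.injective_of_card hc).eq_iff], Finset.sum_singleton] at hi

theorem lodayPoint_injOn (t : PT (m + 1)) (ω : Fin (m + 1) → ℕ+) :
    Set.InjOn (t.lodayPoint ω) t.maximalNestings := by
  intro 𝒩 h 𝒩' h' heq
  obtain ⟨hn, hc⟩ := mem_maximalNestings.1 h
  obtain ⟨hn', hc'⟩ := mem_maximalNestings.1 h'
  exact Finset.eq_of_subset_of_card_le
    ((lodayPoint_mem_face hn h').1 ((mem_face_of_maximal h).2 heq.symm)) (hc'.trans hc.symm).le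

theorem lodayPoint_mem_extremePoints (h : 𝒩 ∈ t.maximalNestings) :
    t.lodayPoint ω 𝒩 ∈ (t.lodayPolytope ω).extremePoints ℝ := by
  rw [← isExtreme_singleton]
  have hs : t.face ω 𝒩 = {t.lodayPoint ω 𝒩} := Set.ext fun x => mem_face_of_maximal h
  rw [← hs]
  exact (isExposed_face (mem_maximalNestings.1 h).1 ω).isExtreme

theorem bijOn_lodayPoint (t : PT (m + 1)) (ω : Fin (m + 1) → ℕ+) :
    Set.BijOn (t.lodayPoint ω) t.maximalNestings ((t.lodayPolytope ω).extremePoints ℝ) :=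
  ⟨fun _ h => lodayPoint_mem_extremePoints h, t.lodayPoint_injOn ω,
    fun _ h => extremePoints_convexHull_subset h⟩

/-- The face for an element of the lattice of nestings. -/
def latticeFace (t : PT (m + 1)) (ω : Fin (m + 1) → ℕ+) : WithTop t.Nesting → Set (E m)
  | ⊤ => ∅
  | (𝒩 : t.Nesting) => t.face ω 𝒩.1

theorem isExposed_latticeFace (ω : Fin (m + 1) → ℕ+) (a : WithTop t.Nesting) :
    IsExposed ℝ (t.lodayPolytope ω) (t.latticeFace ω a) := by
  induction a using WithTop.recTopCoe with
  | top => exact isExposed_empty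
  | coe 𝒩 => exact isExposed_face 𝒩.2 ω

theorem latticeFace_subset (ω : Fin (m + 1) → ℕ+) (a b : WithTop t.Nesting) :
    t.latticeFace ω a ⊆ t.latticeFace ω b ↔ b ≤ a := by
  induction a using WithTop.recTopCoe with
  | top => exact ⟨fun _ => le_top, fun _ => Set.empty_subset _⟩
  | coe 𝒩 =>
    induction b using WithTop.recTopCoe with
    | top =>
      refine ⟨fun h => ?_, fun h => absurd h (WithTop.not_top_le_coe _)⟩
      obtain ⟨x, hx⟩ := face_nonempty 𝒩.2 ω
      exact absurd (h hx) (Set.notMem_empty x)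
    | coe 𝒩' => exact (show _ ↔ 𝒩' ≤ 𝒩 from face_subset_face 𝒩.2 𝒩'.2).trans WithTop.coe_le_coe.symm

theorem isRealization_lodayPolytope (t : PT (m + 1)) (ω : Fin (m + 1) → ℕ+) :
    t.IsRealization (t.lodayPolytope ω) (t.lodayPoint ω) := by
  let f : (WithTop t.Nesting)ᵒᵈ ↪o {F : Set (E m) // IsExposed ℝ (t.lodayPolytope ω) F} :=
    OrderEmbedding.ofMapLEIff
      (fun a => ⟨t.latticeFace ω (OrderDual.ofDual a), isExposed_latticeFace ω _⟩)
      fun a b => latticeFace_subset ω (OrderDual.ofDual a) (OrderDual.ofDual b)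
  refine ⟨RelIso.ofSurjective f ?_, fun 𝒩 h => Set.ext fun x => mem_face_of_maximal h⟩
  rintro ⟨F, hF⟩
  rcases Set.eq_empty_or_nonempty F with rfl | hne
  · exact ⟨OrderDual.toDual ⊤, rfl⟩
  · obtain ⟨𝒩, h, rfl⟩ := exists_face_eq hF hne
    exact ⟨OrderDual.toDual ((⟨𝒩, h⟩ : t.Nesting) : WithTop t.Nesting), rfl⟩

end FaceLattice

/-! ## Flips of maximal nestings -/

section Flips

variable {𝒩 𝒩' : Finset (Finset (Fin m))} {N N' K : Finset (Fin m)} {e f : Fin m}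
  {ω : Fin (m + 1) → ℕ+} {v x y d : E m}

theorem minNest_erase (h : 𝒩 ∈ t.maximalNestings) (hM : t.IsNesting (𝒩.erase (minNest 𝒩 e)))
    (hfe : f ≠ e) : minNest (𝒩.erase (minNest 𝒩 e)) f = minNest 𝒩 f := by
  obtain ⟨hn, hc⟩ := mem_maximalNestings.1 h
  exact hM.minNest_eq (Finset.mem_erase.2 ⟨fun h => hfe (hn.injective_of_card hc h),
    hn.minNest_mem f⟩) (hn.mem_minNest f)
    fun N hN => hn.minNest_subset (Finset.mem_of_mem_erase hN)

/-- If a nest is removed from a maximal nesting, then its edge falls to the next larger nest. -/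
theorem exists_minNest_erase_eq (h : 𝒩 ∈ t.maximalNestings)
    (hM : t.IsNesting (𝒩.erase (minNest 𝒩 e))) :
    ∃ f, f ≠ e ∧ minNest 𝒩 f = minNest (𝒩.erase (minNest 𝒩 e)) e ∧
      minNest 𝒩 e ⊂ minNest 𝒩 f ∧
      ∀ a ∈ minNest 𝒩 e, ∀ b ∈ minNest 𝒩 f, b ≠ f → t.EdgeAdj a b → b ∈ minNest 𝒩 e := by
  obtain ⟨hn, hc⟩ := mem_maximalNestings.1 h
  obtain ⟨hK1, hK2⟩ := Finset.mem_erase.1 (hM.minNest_mem e)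
  obtain ⟨f, -, hf⟩ := hn.exists_minNest_eq hK2
  have hlt : minNest 𝒩 e ⊂ minNest 𝒩 f := by
    rw [hf]
    exact Finset.ssubset_iff_subset_ne.2 ⟨hn.minNest_subset hK2 (hM.mem_minNest e), hK1.symm⟩
  refine ⟨f, fun h => hK1 (by rw [← hf, h]), hf, hlt, fun a ha b hb hbf hab => ?_⟩
  rcases hn.comparable (hn.minNest_mem b) (hn.minNest_mem e) (hn.mem_minNest b) ha hab.symm with
    h1 | h1
  · exact h1 (hn.mem_minNest b)
  · have h2 : minNest 𝒩 f ⊆ minNest 𝒩 b := by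
      rw [hf]
      exact hM.minNest_subset (Finset.mem_erase.2 ⟨h1.ne', hn.minNest_mem b⟩)
        (h1.subset (hn.mem_minNest e))
    exact absurd (hn.injective_of_card hc
      ((hn.minNest_subset (hn.minNest_mem f) hb).antisymm h2)) hbf

/-- The maximal nestings `𝒩` and `𝒩'` differ in one nest, and the nest `K` is cut first at `f` and
then at `e` in `𝒩`, and first at `e` and then at `f` in `𝒩'`. -/
structure IsFlip (t : PT (m + 1)) (𝒩 𝒩' : Finset (Finset (Fin m))) (K : Finset (Fin m))
    (e f : Fin m) : Prop where
  left : 𝒩 ∈ t.maximalNestings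
  right : 𝒩' ∈ t.maximalNestings
  ne : e ≠ f
  erase_eq : 𝒩.erase (minNest 𝒩 e) = 𝒩'.erase (minNest 𝒩' f)
  nesting : t.IsNesting (𝒩.erase (minNest 𝒩 e))
  cut_left : minNest 𝒩 f = K
  cut_right : minNest 𝒩' e = K
  closed_left : ∀ a ∈ minNest 𝒩 e, ∀ b ∈ K, b ≠ f → t.EdgeAdj a b → b ∈ minNest 𝒩 e
  closed_right : ∀ a ∈ minNest 𝒩' f, ∀ b ∈ K, b ≠ e → t.EdgeAdj a b → b ∈ minNest 𝒩' f
  ssubset_left : minNest 𝒩 e ⊂ K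
  ssubset_right : minNest 𝒩' f ⊂ K

theorem IsFlip.symm (h : t.IsFlip 𝒩 𝒩' K e f) : t.IsFlip 𝒩' 𝒩 K f e :=
  ⟨h.right, h.left, h.ne.symm, h.erase_eq.symm, h.erase_eq ▸ h.nesting, h.cut_right, h.cut_left,
    h.closed_right, h.closed_left, h.ssubset_right, h.ssubset_left⟩

theorem IsFlip.mem_left (h : t.IsFlip 𝒩 𝒩' K e f) : e ∈ minNest 𝒩 e :=
  (mem_maximalNestings.1 h.left).1.mem_minNest e

theorem IsFlip.notMem_left (h : t.IsFlip 𝒩 𝒩' K e f) : f ∉ minNest 𝒩 e := by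
  have hn := (mem_maximalNestings.1 h.left).1
  intro hf
  have := hn.minNest_subset (hn.minNest_mem e) hf
  rw [h.cut_left] at this
  exact h.ssubset_left.not_subset this

/-- Removing the differing nests leaves a common nesting in which exactly two edges share a smallest
nest `K`. Each removed nest is the part around one of these edges when `K` is cut at the other. -/
theorem exists_isFlip (h : 𝒩 ∈ t.maximalNestings) (h' : 𝒩' ∈ t.maximalNestings) (hN : N ∈ 𝒩)
    (hN' : N' ∈ 𝒩') (heq : 𝒩.erase N = 𝒩'.erase N') (hne : N ≠ N') :
    ∃ K e f, t.IsFlip 𝒩 𝒩' K e f ∧ minNest 𝒩 e = N ∧ minNest 𝒩' f = N' := by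
  obtain ⟨hn, hc⟩ := mem_maximalNestings.1 h
  obtain ⟨hn', hc'⟩ := mem_maximalNestings.1 h'
  have hM : t.IsNesting (𝒩.erase N) := by
    refine hn.of_subset (Finset.erase_subset _ _) fun hm => ?_
    by_cases hu : Finset.univ = N
    · rw [heq]
      exact Finset.mem_erase.2 ⟨fun h => hne (hu.symm.trans h), hn'.trivial_mem hm⟩
    · exact Finset.mem_erase.2 ⟨hu, hn.trivial_mem hm⟩
  have hM' : t.IsNesting (𝒩'.erase N') := heq ▸ hM
  obtain ⟨e, -, rfl⟩ := hn.exists_minNest_eq hN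
  obtain ⟨f, -, rfl⟩ := hn'.exists_minNest_eq hN'
  obtain ⟨a, ha, ha1, ha2, ha3⟩ := exists_minNest_erase_eq h hM
  obtain ⟨b, hb, hb1, hb2, hb3⟩ := exists_minNest_erase_eq h' hM'
  have hE : ∀ g, g ≠ e → minNest 𝒩 g = minNest (𝒩.erase (minNest 𝒩 e)) g := fun g hg =>
    (minNest_erase h hM hg).symm
  have hE' : ∀ g, g ≠ f → minNest 𝒩' g = minNest (𝒩.erase (minNest 𝒩 e)) g := fun g hg =>
    ((congrArg (minNest · g) heq).trans (minNest_erase h' hM' hg)).symm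
  have hbeq : minNest 𝒩' b = minNest (𝒩.erase (minNest 𝒩 e)) f := by rw [hb1, heq]
  have hinj := hn.injective_of_card hc
  have hinj' := hn'.injective_of_card hc'
  -- If `e = f`, both removed nests are the component of `e` in the same nest cut at the same edge,
  -- hence equal.
  have hef : e ≠ f := by
    rintro rfl
    have hab : a = b := hinj' (by rw [hE' a ha, ← hE a ha, ha1, hbeq])
    subst hab
    have hK : minNest 𝒩 a = minNest 𝒩' a := by rw [ha1, hbeq]
    refine hne (Finset.Subset.antisymm ?_ ?_)
    · refine (hn.nest _ hN).subset_of_closed (hn.mem_minNest e) (hn'.mem_minNest e)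
        fun c hc d hd hcd => hb3 c hc d (hK ▸ ha2.subset hd) ?_ hcd
      rintro rfl
      exact ha2.not_subset (hn.minNest_subset hN hd)
    · refine (hn'.nest _ hN').subset_of_closed (hn'.mem_minNest e) (hn.mem_minNest e)
        fun c hc d hd hcd => ha3 c hc d (hK ▸ hb2.subset hd) ?_ hcd
      rintro rfl
      exact hb2.not_subset (hn'.minNest_subset hN' hd)
  have haf : a = f := by
    by_contra haf
    exact ha (hinj' (by rw [hE' a haf, ← hE a ha, ha1, hE' e hef]))
  have hbe : b = e := by
    by_contra hbe
    exact hb (hinj (by rw [hE b hbe, ← hE' b hb, hbeq, hE f hef.symm]))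
  subst haf hbe
  have hK : minNest 𝒩' b = minNest 𝒩 a := by rw [hbeq, hE a ha]
  exact ⟨minNest 𝒩 a, b, a, ⟨h, h', hef, heq, hM, rfl, hK, ha3, hK ▸ hb3, ha2, hK ▸ hb2⟩,
    rfl, rfl⟩

/-- The vector `e_e - e_f`. -/
noncomputable def flipDirection (e f : Fin m) : E m :=
  EuclideanSpace.single e 1 - EuclideanSpace.single f 1

theorem edgeSum_flipDirection (N : Finset (Fin m)) (e f : Fin m) :
    edgeSum N (flipDirection e f) = (if e ∈ N then 1 else 0) - if f ∈ N then 1 else 0 := by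
  rw [edgeSum_apply]
  simp [flipDirection, Finset.sum_sub_distrib, PiLp.single_apply]

theorem inner_flipDirection (e f : Fin m) (v : E m) :
    inner ℝ (flipDirection e f) v = v e - v f := by
  simp [flipDirection, inner_sub_left, EuclideanSpace.inner_single_left]

/-- The blocks of the common nesting are single edges except for `{e, f}`. -/
theorem IsFlip.exists_eq_smul (h : t.IsFlip 𝒩 𝒩' K e f)
    (hd : ∀ L ∈ 𝒩.erase (minNest 𝒩 e), edgeSum L d = 0) : ∃ a : ℝ, d = a • flipDirection e f := by
  classical
  obtain ⟨hn, hc⟩ := mem_maximalNestings.1 h.left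
  have hinj := hn.injective_of_card hc
  have hE : ∀ g, g ≠ e → minNest (𝒩.erase (minNest 𝒩 e)) g = minNest 𝒩 g := fun g hg =>
    minNest_erase h.left h.nesting hg
  have hEe : minNest (𝒩.erase (minNest 𝒩 e)) e = minNest 𝒩 f := by
    have := minNest_erase h.right (h.erase_eq ▸ h.nesting) h.ne
    rw [h.erase_eq, this, h.cut_right, h.cut_left]
  have hb := h.nesting.sum_blocks_eq_zero (d := fun i => d i) fun N hN => by
    rw [← edgeSum_apply]; exact hd N hN
  have hother : ∀ i, i ≠ e → i ≠ f → d i = 0 := by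
    intro i hie hif
    have hi := hb (minNest 𝒩 i)
    rwa [show Finset.univ.filter (minNest (𝒩.erase (minNest 𝒩 e)) · = minNest 𝒩 i) = {i} by
      ext j
      simp only [Finset.mem_filter, Finset.mem_univ, true_and, Finset.mem_singleton]
      by_cases hj : j = e
      · subst hj
        rw [hEe, hinj.eq_iff]
        exact ⟨fun h => absurd h.symm hif, fun h => absurd h.symm hie⟩
      · rw [hE j hj, hinj.eq_iff], Finset.sum_singleton] at hi
  have hsum : d e + d f = 0 := by
    have hf := hb (minNest 𝒩 f)
    rwa [show Finset.univ.filter (minNest (𝒩.erase (minNest 𝒩 e)) · = minNest 𝒩 f) = {e, f} by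
      ext j
      simp only [Finset.mem_filter, Finset.mem_univ, true_and, Finset.mem_singleton,
        Finset.mem_insert]
      by_cases hj : j = e
      · subst hj
        simp [hEe]
      · simp [hE j hj, hinj.eq_iff, hj], Finset.sum_pair h.ne] at hf
  refine ⟨d e, PiLp.ext fun i => ?_⟩
  by_cases hie : i = e
  · subst hie
    simp [flipDirection, h.ne]
  · by_cases hif : i = f
    · subst hif
      simp [flipDirection, hie]
      linarith
    · simp [flipDirection, hie, hif, hother i hie hif]

/-- The nest of `e` in `𝒩` contains `e` but not `f`. It is tight at the point of `𝒩` and not at that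
of `𝒩'`, which fixes the sign. -/
theorem IsFlip.exists_sub_eq (h : t.IsFlip 𝒩 𝒩' K e f) (ω : Fin (m + 1) → ℕ+) :
    ∃ a : ℝ, 0 < a ∧ t.lodayPoint ω 𝒩' - t.lodayPoint ω 𝒩 = a • flipDirection e f := by
  have hn := (mem_maximalNestings.1 h.left).1
  obtain ⟨a, ha⟩ := h.exists_eq_smul (d := t.lodayPoint ω 𝒩' - t.lodayPoint ω 𝒩) fun L hL => by
    rw [map_sub, edgeSum_apply, edgeSum_apply, sum_eq_bound h.left ω (Finset.mem_of_mem_erase hL),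
      sum_eq_bound h.right ω (Finset.mem_of_mem_erase (h.erase_eq ▸ hL)), sub_self]
  refine ⟨a, ?_, ha⟩
  have hmem := hn.minNest_mem e
  have hnot : minNest 𝒩 e ∉ 𝒩' := fun hmem' => by
    have h1 := (mem_maximalNestings.1 h.right).1.minNest_subset hmem' h.mem_left
    rw [h.cut_right] at h1
    exact h.ssubset_left.not_subset h1
  have h1 := bound_lt_sum h.right ω (hn.nest _ hmem) hnot
  have h2 := congrArg (edgeSum (minNest 𝒩 e)) ha
  rw [map_sub, map_smul, edgeSum_flipDirection, if_pos h.mem_left, if_neg h.notMem_left,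
    edgeSum_apply, edgeSum_apply, sum_eq_bound h.left ω hmem, smul_eq_mul] at h2
  linarith

/-- The face of the common nesting lies on a line, and the inequalities of the two exchanged nests
confine it to the segment. -/
theorem IsFlip.isEdge (h : t.IsFlip 𝒩 𝒩' K e f) (ω : Fin (m + 1) → ℕ+) :
    IsEdge (t.lodayPolytope ω) (t.lodayPoint ω 𝒩) (t.lodayPoint ω 𝒩') := by
  obtain ⟨a, ha, hsub⟩ := h.exists_sub_eq ω
  have hl := (lodayPoint_mem_face (ω := ω) h.nesting h.left).2 (Finset.erase_subset _ _)
  have hr := (lodayPoint_mem_face (ω := ω) h.nesting h.right).2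
    (h.erase_eq ▸ Finset.erase_subset _ _)
  have hdir : (flipDirection e f : E m) ≠ 0 := fun h0 => by
    have := edgeSum_flipDirection (minNest 𝒩 e) e f
    rw [h0, map_zero, if_pos h.mem_left, if_neg h.notMem_left] at this
    norm_num at this
  refine ⟨fun heq => ?_, ?_⟩
  · rw [heq, sub_self, eq_comm, smul_eq_zero] at hsub
    exact hsub.elim ha.ne' hdir
  have hexp := isExposed_face h.nesting ω
  suffices t.face ω (𝒩.erase (minNest 𝒩 e)) =
      segment ℝ (t.lodayPoint ω 𝒩) (t.lodayPoint ω 𝒩') from this ▸ hexp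
  refine Set.Subset.antisymm (fun x hx => ?_)
    ((hexp.convex (t.convex_lodayPolytope ω)).segment_subset hl hr)
  obtain ⟨b, hb⟩ := h.exists_eq_smul (d := x - t.lodayPoint ω 𝒩) fun L hL => by
    rw [map_sub, hx.2 L hL, hl.2 L hL, sub_self]
  have hb0 : 0 ≤ b := by
    have h1 := congrArg (edgeSum (minNest 𝒩 e)) hb
    rw [map_sub, map_smul, edgeSum_flipDirection, if_pos h.mem_left, if_neg h.notMem_left,
      edgeSum_apply _ (t.lodayPoint ω 𝒩), sum_eq_bound h.left ω
        ((mem_maximalNestings.1 h.left).1.minNest_mem e), smul_eq_mul] at h1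
    linarith [bound_le_edgeSum hx.1 (minNest 𝒩 e)]
  have hba : b ≤ a := by
    have hx' : x - t.lodayPoint ω 𝒩' = (b - a) • flipDirection e f := by
      rw [sub_smul, ← hb, ← hsub]; abel
    have h1 := congrArg (edgeSum (minNest 𝒩' f)) hx'
    rw [map_sub, map_smul, edgeSum_flipDirection, if_pos h.symm.mem_left,
      if_neg h.symm.notMem_left, edgeSum_apply _ (t.lodayPoint ω 𝒩'), sum_eq_bound h.right ω
        ((mem_maximalNestings.1 h.right).1.minNest_mem f), smul_eq_mul] at h1
    linarith [bound_le_edgeSum hx.1 (minNest 𝒩' f)]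
  rw [segment_eq_image']
  refine ⟨b / a, ⟨div_nonneg hb0 ha.le, (div_le_one ha).2 hba⟩, ?_⟩
  show _ + _ = x
  rw [hsub, smul_smul, div_mul_cancel₀ b ha.ne', ← hb]
  abel

/-- The edge is the face of a nesting `ℳ` contained in only two maximal nestings. Were `N` and `L`
two nests of `𝒩` outside `ℳ`, with `N ∉ 𝒩'`, then `ℳ` with `N` added would extend to a maximal
nesting without `L`, a third one. -/
theorem exists_isFlip_of_isEdge (h : 𝒩 ∈ t.maximalNestings) (h' : 𝒩' ∈ t.maximalNestings)
    (hE : IsEdge (t.lodayPolytope ω) (t.lodayPoint ω 𝒩) (t.lodayPoint ω 𝒩')) :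
    ∃ K e f, t.IsFlip 𝒩 𝒩' K e f := by
  obtain ⟨hne, hexp⟩ := hE
  obtain ⟨ℳ, hM, hface⟩ := exists_face_eq hexp ⟨_, left_mem_segment ℝ _ _⟩
  have hs := (lodayPoint_mem_face (ω := ω) hM h).1 (hface ▸ left_mem_segment ℝ _ _)
  have hs' := (lodayPoint_mem_face (ω := ω) hM h').1 (hface ▸ right_mem_segment ℝ _ _)
  have honly : ∀ ℒ ∈ t.maximalNestings, ℳ ⊆ ℒ → ℒ = 𝒩 ∨ ℒ = 𝒩' := by
    intro ℒ hℒ hsub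
    have hmem : t.lodayPoint ω ℒ ∈ segment ℝ (t.lodayPoint ω 𝒩) (t.lodayPoint ω 𝒩') :=
      hface ▸ (lodayPoint_mem_face hM hℒ).2 hsub
    have hext := (mem_extremePoints_iff_forall_segment.1 (lodayPoint_mem_extremePoints (ω := ω) hℒ)).2
      _ (lodayPoint_mem h ω) _ (lodayPoint_mem h' ω) hmem
    exact hext.imp (fun h1 => (t.lodayPoint_injOn ω h hℒ h1).symm)
      fun h1 => (t.lodayPoint_injOn ω h' hℒ h1).symm
  have key : ∀ {𝒩 𝒩' : Finset (Finset (Fin m))}, 𝒩 ∈ t.maximalNestings →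
      𝒩' ∈ t.maximalNestings → 𝒩 ≠ 𝒩' → ℳ ⊆ 𝒩 → ℳ ⊆ 𝒩' →
      (∀ ℒ ∈ t.maximalNestings, ℳ ⊆ ℒ → ℒ = 𝒩 ∨ ℒ = 𝒩') → ∃ N ∈ 𝒩, N ∉ 𝒩' ∧ 𝒩.erase N = ℳ := by
    intro 𝒩 𝒩' h h' hne hs hs' honly
    obtain ⟨hn, hc⟩ := mem_maximalNestings.1 h
    obtain ⟨hn', hc'⟩ := mem_maximalNestings.1 h'
    obtain ⟨N, hN, hN'⟩ : ∃ N ∈ 𝒩, N ∉ 𝒩' := Finset.not_subset.1 fun hsub =>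
      hne (Finset.eq_of_subset_of_card_le hsub (hc'.trans hc.symm).le)
    refine ⟨N, hN, hN', Finset.Subset.antisymm (fun L hL => ?_) fun L hL =>
      Finset.mem_erase.2 ⟨fun h => hN' (h ▸ hs' hL), hs hL⟩⟩
    by_contra hLM
    obtain ⟨hLN, hL⟩ := Finset.mem_erase.1 hL
    have hn₁ : t.IsNesting (insert N ℳ) := hn.of_subset (Finset.insert_subset hN hs)
      fun hm => Finset.mem_insert_of_mem (hM.trivial_mem hm)
    obtain ⟨ℒ, hℒ, hsub, hLℒ⟩ := hn₁.exists_maximal_notMem (hn.nest L hL)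
      fun h => (Finset.mem_insert.1 h).elim hLN hLM
    rcases honly ℒ hℒ ((Finset.subset_insert _ _).trans hsub) with rfl | rfl
    · exact hLℒ hL
    · exact hN' (hsub (Finset.mem_insert_self _ _))
  have hne' : 𝒩 ≠ 𝒩' := fun h => hne (by rw [h])
  obtain ⟨N, hN, hN1, hN2⟩ := key h h' hne' hs hs' honly
  obtain ⟨N', hN', -, hN2'⟩ := key h' h hne'.symm hs' hs fun ℒ h1 h2 => (honly ℒ h1 h2).symm
  obtain ⟨K, e, f, hflip, -, -⟩ := exists_isFlip h h' hN hN' (hN2.trans hN2'.symm)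
    fun h => hN1 (h ▸ hN')
  exact ⟨K, e, f, hflip⟩

end Flips

end Operahedra.PT

namespace Operahedra.PT

variable {m : ℕ} {t : PT (m + 1)}

/-! ## Covering relations -/

section Covers

variable {𝒩 𝒩' : Finset (Finset (Fin m))} {N S K : Finset (Fin m)} {e f : Fin m}
  {T U : Finset (Fin (m + 1))} {x y a : Fin (m + 1)} {ω : Fin (m + 1) → ℕ+} {v : E m}

theorem mem_inside : e ∈ t.inside T ↔ t.src e ∈ T ∧ t.tgt e ∈ T := by simp [inside]

theorem isSubtree_of_mem_iff_reach (hT : ∀ x, x ∈ T ↔ t.Reach S a x) : t.IsSubtree T := by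
  have ha : a ∈ (T : Set (Fin (m + 1))) := (hT a).2 (Reach.refl ..)
  have key : ∀ x, t.Reach S a x → ∃ hx : x ∈ (T : Set (Fin (m + 1))),
      ((t.edgeGraph Finset.univ).induce (T : Set (Fin (m + 1)))).Reachable ⟨a, ha⟩ ⟨x, hx⟩ := by
    intro x hx
    refine hx.induct (p := fun x => ∃ hx : x ∈ (T : Set (Fin (m + 1))),
      ((t.edgeGraph Finset.univ).induce (T : Set (Fin (m + 1)))).Reachable ⟨a, ha⟩ ⟨x, hx⟩)
      ⟨ha, SimpleGraph.Reachable.refl _⟩ ?_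
    rintro g hg b c hb hc hab ⟨_, h⟩
    refine ⟨(hT c).2 (hab.trans (Reach.of_incident hg hb hc)), ?_⟩
    by_cases hbc : b = c
    · subst hbc; exact h
    refine h.trans (SimpleGraph.Adj.reachable ?_)
    show (t.edgeGraph Finset.univ).Adj b c
    rcases hb with rfl | rfl <;> rcases hc with rfl | rfl
    · exact absurd rfl hbc
    · exact ⟨g, Finset.mem_univ g, Or.inl ⟨rfl, rfl⟩⟩
    · exact ⟨g, Finset.mem_univ g, Or.inr ⟨rfl, rfl⟩⟩
    · exact absurd rfl hbc
  have : Nonempty (T : Set (Fin (m + 1))) := ⟨⟨a, ha⟩⟩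
  refine ⟨fun x y => ?_⟩
  exact (key x ((hT x).1 x.2)).2.symm.trans (key y ((hT y).1 y.2)).2

/-- A nest that is a connected component of `S` as the set of edges inside a component. -/
theorem IsNest.eq_inside (hN : t.IsNest N) (hNS : N ⊆ S) (he : e ∈ N) (ha : t.Incident e a)
    (hcl : ∀ a ∈ N, ∀ b ∈ S, t.EdgeAdj a b → b ∈ N) (hT : ∀ x, x ∈ T ↔ t.Reach S a x) :
    N = t.inside T := by
  ext g
  rw [mem_inside, hT, hT]
  constructor
  · exact fun hg => ⟨(hN.reach he hg ha (t.incident_src g)).mono hNS,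
      (hN.reach he hg ha (t.incident_tgt g)).mono hNS⟩
  · rintro ⟨h1, h2⟩
    have hgS : g ∈ S := by
      by_contra hgS
      exact not_reach_of_notMem hgS (h1.symm.trans h2)
    obtain ⟨-, b, hb, hb'⟩ := h1.mem_of_closed he ha hcl
    exact hcl b hb g hgS ⟨_, hb', t.incident_src g⟩

/-- In a subtree, an edge at the vertex `x` is adjacent to an edge of each larger set that meets
the subtree. -/
theorem IsSubtree.exists_adj (h : t.IsSubtree T) (hx : x ∈ T) (hy : y ∈ T) (hex : t.Incident e x)
    (hfy : t.Incident f y) (hTU : T ⊆ U) (hf : f ∈ t.inside U) :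
    ∃ g ∈ t.inside U, t.EdgeAdj g e := by
  obtain ⟨w⟩ := h.preconnected ⟨x, hx⟩ ⟨y, hy⟩
  cases w with
  | nil => exact ⟨f, hf, x, hfy, hex⟩
  | @cons _ z _ hadj _ =>
    obtain ⟨g, -, ⟨h1, h2⟩ | ⟨h1, h2⟩⟩ := hadj
    · refine ⟨g, mem_inside.2 ⟨?_, ?_⟩, x, Or.inl h1, hex⟩
      · exact h1 ▸ hTU hx
      · exact h2 ▸ hTU z.2
    · refine ⟨g, mem_inside.2 ⟨?_, ?_⟩, x, Or.inr h1, hex⟩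
      · exact h2 ▸ hTU z.2
      · exact h1 ▸ hTU hx

/-- Here `e` is the root of `T`: paths inside `T` from its upper end cannot use `e`, so they stay
above it. -/
theorem IsSubtree.above (h : t.IsSubtree T) (he : t.src e ∉ T) (he' : t.tgt e ∈ T) (hx : x ∈ T) :
    t.Above e x := by
  obtain ⟨w⟩ := h.preconnected ⟨t.tgt e, he'⟩ ⟨x, hx⟩
  suffices ∀ (a b : (T : Set (Fin (m + 1))))
      (_ : ((t.edgeGraph Finset.univ).induce (T : Set (Fin (m + 1)))).Walk a b),
      t.Above e a → t.Above e b from this _ _ w (t.above_tgt e)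
  intro a b w
  induction w with
  | nil => exact id
  | @cons a z b hadj _ ih =>
    refine fun ha => ih ?_
    obtain ⟨g, -, ⟨h1, h2⟩ | ⟨h1, h2⟩⟩ := hadj
    all_goals
      simp only [Function.Embedding.subtype_apply] at h1 h2
      have hge : g ≠ e := by
        rintro rfl
        first | exact he (h1 ▸ a.2) | exact he (h2 ▸ z.2)
    · rw [h2, ← above_src_iff_tgt hge, ← h1]; exact ha
    · rw [h2, above_src_iff_tgt hge, ← h1]; exact ha

/-- Cutting `K` at `e` and `f` leaves three subtrees: `T₁` at the lower end of `e`, `T₂` at its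
upper end, and `T₃` at the upper end of `f`. As `e < f`, neither end of `e` is above `f`, so `T₃` is
grafted on `T₁` or on `T₂`; these are the two covering relations. -/
theorem IsFlip.covers (h : t.IsFlip 𝒩 𝒩' K e f) (hef : e < f) : t.Covers 𝒩 𝒩' := by
  classical
  have hn := (mem_maximalNestings.1 h.left).1
  have hn' := (mem_maximalNestings.1 h.right).1
  have heK : e ∈ K := h.ssubset_left.subset h.mem_left
  have hfK : f ∈ K := h.ssubset_right.subset h.symm.mem_left
  have htgt : t.tgt e < t.tgt f := Fin.succ_lt_succ_iff.2 hef
  have hsrc : t.src e < t.tgt f := (t.src_lt_tgt e).trans htgt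
  let K₀ := (K.erase f).erase e
  have hK₀ : K₀ = (K.erase e).erase f := Finset.erase_right_comm
  have heK₀ : e ∉ K₀ := Finset.notMem_erase e _
  have hfK₀ : f ∉ K₀ := hK₀ ▸ Finset.notMem_erase f _
  have hef' : e ∈ K.erase f := Finset.mem_erase.2 ⟨h.ne, heK⟩
  have hfe' : f ∈ K.erase e := Finset.mem_erase.2 ⟨h.ne.symm, hfK⟩
  let C : Fin (m + 1) → Finset (Fin (m + 1)) := fun a => Finset.univ.filter (t.Reach K₀ a)
  have hC : ∀ a x, x ∈ C a ↔ t.Reach K₀ a x := fun a x => by simp [C]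
  have hdisj : ∀ a b, ¬ t.Reach K₀ a b → Disjoint (C a) (C b) := fun a b hab =>
    Finset.disjoint_left.2 fun x ha hb => hab (((hC a x).1 ha).trans ((hC b x).1 hb).symm)
  have habove : ∀ S x, f ∉ S → x < t.tgt f → ¬ t.Reach S x (t.tgt f) := fun S x hS hx hr =>
    not_le.2 hx (Above.of_reach hr.symm hS (t.above_tgt f)).le
  -- `src e` is on the lower side of `f`, since every vertex above `f` has at least the number of
  -- `tgt f`.
  have hsf : t.Reach (K.erase f) (t.src e) (t.src f) := by
    by_contra hcon
    have hK : t.IsNest K := h.cut_left ▸ hn.nest _ (hn.minNest_mem f)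
    rcases (separated_iff hfK).1 ⟨hK.reach heK hfK (t.incident_src e) (t.incident_src f), hcon⟩
      with h1 | h1
    · exact habove _ _ (Finset.notMem_erase f K) hsrc h1.1.symm
    · exact hcon (h1.1.symm.trans (Reach.refl ..))
  have hleft : minNest 𝒩 e = t.inside (C (t.src e) ∪ C (t.tgt e)) := by
    refine (hn.nest _ (hn.minNest_mem e)).eq_inside (S := K.erase f) (e := e) (a := t.src e)
      (fun g hg => Finset.mem_erase.2 ⟨?_, h.ssubset_left.subset hg⟩) h.mem_left
      (t.incident_src e) (fun a ha b hb => h.closed_left a ha b (Finset.mem_of_mem_erase hb)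
        (Finset.ne_of_mem_erase hb)) fun x => ?_
    · rintro rfl
      exact h.notMem_left hg
    · rw [Finset.mem_union, hC, hC, reach_src_iff hef']
  have hright : ∀ b, t.Reach K₀ b (t.src f) →
      minNest 𝒩' f = t.inside (C b ∪ C (t.tgt f)) := by
    intro b hb
    refine (hn'.nest _ (hn'.minNest_mem f)).eq_inside (S := K.erase e) (e := f) (a := t.src f)
      (fun g hg => Finset.mem_erase.2 ⟨?_, h.ssubset_right.subset hg⟩) h.symm.mem_left
      (t.incident_src f) (fun a ha b hb => h.closed_right a ha b (Finset.mem_of_mem_erase hb)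
        (Finset.ne_of_mem_erase hb)) fun x => ?_
    · rintro rfl
      exact h.symm.notMem_left hg
    · rw [Finset.mem_union, hC, hC, reach_src_iff hfe', ← hK₀]
      exact or_congr_left ⟨fun h => hb.symm.trans h, fun h => hb.trans h⟩
  refine ⟨h.left, h.right, minNest 𝒩 e, minNest 𝒩' f, C (t.src e), C (t.tgt e), C (t.tgt f), e, f,
    hn.minNest_mem e, hn'.minNest_mem f, h.erase_eq, isSubtree_of_mem_iff_reach (hC _),
    isSubtree_of_mem_iff_reach (hC _), isSubtree_of_mem_iff_reach (hC _),
    hdisj _ _ (not_reach_of_notMem heK₀), hdisj _ _ (habove _ _ hfK₀ hsrc),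
    hdisj _ _ (habove _ _ hfK₀ htgt), (hC _ _).2 (Reach.refl ..), (hC _ _).2 (Reach.refl ..),
    (hC _ _).2 (Reach.refl ..), hleft, ?_⟩
  rcases (reach_src_iff hef').1 hsf with h1 | h1
  · exact Or.inr ⟨(hC _ _).2 h1, hef, hright _ h1⟩
  · exact Or.inl ⟨(hC _ _).2 h1, hright _ h1⟩

/-- The edge `e` lies outside `N'` but touches it, and within `K` the nest `N'` is closed under
adjacency except at the edge where `K` is cut. So `e` is that edge, and likewise `f` for `N`. -/
theorem Covers.exists_isFlip (h : t.Covers 𝒩 𝒩') :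
    ∃ K e f, t.IsFlip 𝒩 𝒩' K e f ∧ e < f := by
  obtain ⟨h𝒩, h𝒩', N, N', T₁, T₂, T₃, e, f, hN, hN', heq, hT₁, hT₂, hT₃, h12, h13, h23, hse, hte,
    htf, rfl, hcase⟩ := h
  have heN : e ∈ t.inside (T₁ ∪ T₂) :=
    mem_inside.2 ⟨Finset.mem_union_left _ hse, Finset.mem_union_right _ hte⟩
  have hfN : f ∉ t.inside (T₁ ∪ T₂) := fun h =>
    (Finset.mem_union.1 (mem_inside.1 h).2).elim (fun h => Finset.disjoint_left.1 h13 h htf)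
      fun h => Finset.disjoint_left.1 h23 h htf
  have hdata : f ∈ N' ∧ e ∉ N' ∧ e < f ∧ (∃ g ∈ N', t.EdgeAdj g e) ∧
      ∃ g ∈ t.inside (T₁ ∪ T₂), t.EdgeAdj g f := by
    rcases hcase with ⟨hsf, rfl⟩ | ⟨hsf, hef, rfl⟩
    · have hfN' : f ∈ t.inside (T₂ ∪ T₃) :=
        mem_inside.2 ⟨Finset.mem_union_left _ hsf, Finset.mem_union_right _ htf⟩
      -- `T₂` lies above `e` and `f` starts in `T₂`, so the clockwise numbering gives `e < f`.
      have hab := (hT₂.above (Finset.disjoint_left.1 h12 hse) hte hsf).le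
      refine ⟨hfN', fun h => (Finset.mem_union.1 (mem_inside.1 h).1).elim
        (Finset.disjoint_left.1 h12 hse) (Finset.disjoint_left.1 h13 hse),
        Fin.succ_lt_succ_iff.1 (hab.trans_lt (t.src_lt_tgt f)), ?_, ?_⟩
      · exact hT₂.exists_adj hte hsf (t.incident_tgt e) (t.incident_src f)
          Finset.subset_union_left hfN'
      · exact hT₂.exists_adj hsf hte (t.incident_src f) (t.incident_tgt e)
          Finset.subset_union_right heN
    · have hfN' : f ∈ t.inside (T₁ ∪ T₃) :=
        mem_inside.2 ⟨Finset.mem_union_left _ hsf, Finset.mem_union_right _ htf⟩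
      refine ⟨hfN', fun h => (Finset.mem_union.1 (mem_inside.1 h).2).elim
        (fun h => Finset.disjoint_left.1 h12 h hte) (Finset.disjoint_left.1 h23 hte), hef, ?_, ?_⟩
      · exact hT₁.exists_adj hse hsf (t.incident_src e) (t.incident_src f)
          Finset.subset_union_left hfN'
      · exact hT₁.exists_adj hsf hse (t.incident_src f) (t.incident_src e)
          Finset.subset_union_left heN
  obtain ⟨hfN', heN', hef, ⟨a, ha, hae⟩, b, hb, hbf⟩ := hdata
  obtain ⟨K, e', f', hflip, he', hf'⟩ := PT.exists_isFlip h𝒩 h𝒩' hN hN' heq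
    fun h => hfN (h ▸ hfN')
  have hee : e = e' := by
    by_contra hne
    refine heN' (hf' ▸ hflip.closed_right a (hf'.symm ▸ ha) e ?_ hne hae)
    exact hflip.ssubset_left.subset (he'.symm ▸ heN)
  have hff : f = f' := by
    by_contra hne
    refine hfN (he' ▸ hflip.closed_left b (he'.symm ▸ hb) f ?_ hne hbf)
    exact hflip.ssubset_right.subset (hf'.symm ▸ hfN')
  subst hee hff
  exact ⟨K, e, f, hflip, hef⟩

theorem IsFlip.inner_lt_iff (h : t.IsFlip 𝒩 𝒩' K e f) (ω : Fin (m + 1) → ℕ+)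
    (hv : ∀ i j : Fin m, i < j → v j < v i) :
    inner ℝ (t.lodayPoint ω 𝒩) v < inner ℝ (t.lodayPoint ω 𝒩') v ↔ e < f := by
  obtain ⟨a, ha, hsub⟩ := h.exists_sub_eq ω
  rw [← sub_pos, ← inner_sub_left, hsub, real_inner_smul_left, inner_flipDirection,
    mul_pos_iff_of_pos_left ha, sub_pos]
  refine ⟨fun hlt => ?_, hv e f⟩
  by_contra hle
  exact lt_asymm hlt (hv f e (lt_of_le_of_ne (not_lt.1 hle) h.ne.symm))

theorem covers_iff (ω : Fin (m + 1) → ℕ+) (hv : ∀ i j : Fin m, i < j → v j < v i)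
    (h : 𝒩 ∈ t.maximalNestings) (h' : 𝒩' ∈ t.maximalNestings) :
    t.Covers 𝒩 𝒩' ↔ IsEdge (t.lodayPolytope ω) (t.lodayPoint ω 𝒩) (t.lodayPoint ω 𝒩') ∧
      inner ℝ (t.lodayPoint ω 𝒩) v < inner ℝ (t.lodayPoint ω 𝒩') v := by
  constructor
  · intro hc
    obtain ⟨K, e, f, hflip, hef⟩ := hc.exists_isFlip
    exact ⟨hflip.isEdge ω, (hflip.inner_lt_iff ω hv).2 hef⟩
  · rintro ⟨hE, hlt⟩
    obtain ⟨K, e, f, hflip⟩ := exists_isFlip_of_isEdge h h' hE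
    exact hflip.covers ((hflip.inner_lt_iff ω hv).1 hlt)

/-- A chain in `VertexLT` runs through points of the space; this makes them vertices, hence Loday
points. -/
theorem IsEdge.right_mem_extremePoints {P : Set (E m)} {x y : E m} (h : IsEdge P x y) :
    y ∈ P.extremePoints ℝ := by
  refine h.2.isExtreme.extremePoints_subset_extremePoints
    (mem_extremePoints_iff_left.2 ⟨right_mem_segment ℝ x y, ?_⟩)
  rw [segment_eq_image']
  rintro _ ⟨p, hp, rfl⟩ _ ⟨q, hq, rfl⟩ ⟨a, b, ha, hb, hab, heq⟩
  have h0 : (a * p + b * q - 1) • (y - x) = 0 := by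
    have h1 : a • (x + p • (y - x)) + b • (x + q • (y - x)) =
        (a + b) • x + (a * p + b * q) • (y - x) := by module
    have h2 : (a + b) • x + (a * p + b * q) • (y - x) = y := h1.symm.trans heq
    rw [hab, one_smul] at h2
    rw [sub_smul, one_smul, sub_eq_zero, eq_sub_iff_add_eq, add_comm]
    exact h2
  have h1 := (smul_eq_zero.1 h0).resolve_right (sub_ne_zero.2 h.1.symm)
  -- `a * p + b * q = 1` with `a + b = 1`, `a > 0` and `p, q ≤ 1` forces `p = 1`.
  have hp1 : p = 1 := by
    refine le_antisymm hp.2 (le_of_mul_le_mul_left ?_ ha)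
    have := mul_le_mul_of_nonneg_left hq.2 hb.le
    linarith
  simp [hp1]

theorem inducesNestingPoset (ω : Fin (m + 1) → ℕ+) (hv : ∀ i j : Fin m, i < j → v j < v i) :
    t.InducesNestingPoset (t.lodayPolytope ω) v (t.lodayPoint ω) := by
  refine ⟨t.bijOn_lodayPoint ω, fun 𝒩 h 𝒩' h' => ⟨fun hlt => ?_, fun hlt => ?_⟩⟩
  · exact Relation.TransGen.lift (r := t.Covers)
      (p := fun x y => IsEdge (t.lodayPolytope ω) x y ∧ inner ℝ x v < inner ℝ y v)
      (t.lodayPoint ω) (fun a b hab => (covers_iff ω hv hab.1 hab.2.1).1 hab) _ _ hlt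
  · suffices ∀ y, VertexLT (t.lodayPolytope ω) v (t.lodayPoint ω 𝒩) y →
        ∃ ℒ ∈ t.maximalNestings, t.lodayPoint ω ℒ = y ∧ t.NestingLT 𝒩 ℒ by
      obtain ⟨ℒ, hℒ, heq, hr⟩ := this _ hlt
      rwa [t.lodayPoint_injOn ω hℒ h' heq] at hr
    intro y hy
    have hvert : ∀ {x y : E m}, IsEdge (t.lodayPolytope ω) x y →
        ∃ ℒ ∈ t.maximalNestings, t.lodayPoint ω ℒ = y := fun hE =>
      (t.bijOn_lodayPoint ω).surjOn (IsEdge.right_mem_extremePoints hE)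
    induction hy with
    | single hxy =>
      obtain ⟨ℒ, hℒ, rfl⟩ := hvert hxy.1
      exact ⟨ℒ, hℒ, rfl, .single ((covers_iff ω hv h hℒ).2 hxy)⟩
    | tail _ hxy ih =>
      obtain ⟨ℳ, hℳ, rfl, hr⟩ := ih
      obtain ⟨ℒ, hℒ, rfl⟩ := hvert hxy.1
      exact ⟨ℒ, hℒ, rfl, hr.tail ((covers_iff ω hv hℳ hℒ).2 hxy)⟩

end Covers

end Operahedra.PT

-- Assembly of the three statements.

theorem mainTheorem11 (m : ℕ) (v : EuclideanSpace ℝ (Fin m)) :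
    ((∀ p ∈ Operahedra.D m, ∑ i ∈ p.1, v i ≠ ∑ j ∈ p.2, v j) →
      ∀ (t : PT (m + 1)) (ω : Fin (m + 1) → ℕ+),
        PositivelyOriented (t.lodayPolytope ω) v ∧
        DefinesBotTopDiagonal (t.lodayPolytope ω) v) ∧
    ((∀ i j : Fin m, i < j → v j < v i) →
      ∀ (t : PT (m + 1)) (ω : Fin (m + 1) → ℕ+),
        t.InducesNestingPoset (t.lodayPolytope ω) v (t.lodayPoint ω)) ∧
    ((∀ p ∈ Operahedra.D m, ∑ i ∈ p.1, v i ≠ ∑ j ∈ p.2, v j) →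
      (∀ i j : Fin m, i < j → v j < v i) →
      ∀ (t : PT (m + 1)) (ω : Fin (m + 1) → ℕ+),
        t.IsWellOriented (t.lodayPolytope ω) v (t.lodayPoint ω)) :=
  ⟨fun hv _ _ => ⟨PT.positivelyOriented_lodayPolytope hv, PT.definesBotTopDiagonal hv⟩,
    fun hv _ ω => PT.inducesNestingPoset ω hv,
    fun hv hv' t ω => ⟨t.isRealization_lodayPolytope ω, PT.positivelyOriented_lodayPolytope hv,
      PT.inducesNestingPoset ω hv'⟩⟩
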